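/- Let $j\in\{\tfrac12,1,\tfrac32,\dots\}$, let $\mathcal H_j$ be the spin-$j$ space with orthonormal basis $\{|j;m\rangle\}_{m=-j}^{j}$ of eigenvectors of $J_3$, and let $U_{j,g}$ ($g\in \mathrm{SU}(2)$) be the spin-$j$ representation on $\mathcal H_j$. Let $\rho=\sum_{m=-j}^{j}p_m|j;m\rangle\langle j;m|$ with $p_m\ge 0$, $\sum_m p_m=1$. Let $\Theta=\mathrm{SU}(2)/\mathrm{U}(1)$, where $\mathrm{U}(1)$ is the one-parameter group generated by $J_3$, let $\nu$ be the $\mathrm{SU}(2)$-invariant probability measure on $\Theta$, and for $\theta=[g]\in\Theta$ let $\rho_\theta=U_{j,g}\,\rho\,U_{j,g}^\dagger$. For $\theta=[g]$, $\hat\theta=[\hat g]$ let $$R(\theta,\hat\theta)=\mathrm{Tr}\Big(U_{\frac12,g}|\tfrac12;\tfrac12\rangle\langle\tfrac12;\tfrac12|U_{\frac12,g}^\dagger\Big)\Big(U_{\frac12,\hat g}|\tfrac12;\tfrac12\rangle\langle\tfrac12;\tfrac12|U_{\frac12,\hat g}^\dagger\Big).$$ An estimator is a POVM $M$ on $\Theta$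 with values in the operators on $\mathcal H_j$. Its worst-case and Bayesian average gains are $$R(M)=\inf_{\theta\in\Theta}\int_\Theta R(\theta,\hat\theta)\,\mathrm{Tr}\,\rho_\theta M(d\hat\theta),\qquad R_\nu(M)=\int_\Theta\int_\Theta R(\theta,\hat\theta)\,\mathrm{Tr}\,\rho_\theta M(d\hat\theta)\,\nu(d\theta).$$ Under $\mathrm{SU}(2)$, $\mathcal H_{\frac12}\otimes\mathcal H_j=\mathcal H_{j+\frac12}\oplus\mathcal H_{j-\frac12}$; let $P_{j\pm\frac12}$ be the orthogonal projections onto the two summands. Suppose that $$\frac1{2j+2}\mathrm{Tr}\,P_{j+\frac12}\big(|\tfrac12;\tfrac12\rangle\langle\tfrac12;\tfrac12|\otimes\rho\big)\;\ge\;\frac1{2j}\mathrm{Tr}\,P_{j-\frac12}\big(|\tfrac12;\tfrac12\rangle\langle\tfrac12;\tfrac12|\otimes\rho\big).$$ Then the maximum of $R(M)$ over all estimators $M$ and the maximum of $R_\nu(M)$ over all estimators $M$ are both equal to $$\frac{2j+1}{2j+2}\,\mathrm{Tr}\,P_{j+\frac12}\big(|\tfrac12;\tfrac12\rangle\langle\tfrac12;\tfrac12|\otimes\rho\big).$$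 Both maxima are attained by the covariant POVM generated by $|j;j\rangle\langle j;j|$, namely $$M_{|j;j\rangle\langle j;j|}(B)=(2j+1)\int_B U_{j,g(\theta)}|j;j\rangle\langle j;j|U_{j,g(\theta)}^\dagger\,\nu(d\theta),\qquad B\subset\Theta \text{ measurable},$$ where $g(\theta)\in\mathrm{SU}(2)$ is any representative of $\theta$; covariance means $U_{j,g}M(B)U_{j,g}^\dagger=M(gB)$ for all $g\in\mathrm{SU}(2)$ and measurable $B$. -/

import Mathlib

open MeasureTheory
open scoped Matrix Kronecker Pointwise ComplexOrder

noncomputable section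

namespace SpinEstimation

/-! ### The group `SU(2)`, the subgroup `U(1)`, and the parameter space `Θ = SU(2)/U(1)` -/

/-- The group `SU(2)`, with the subspace topology and the induced (Borel) σ-algebra. -/
abbrev SU2 : Type := Matrix.specialUnitaryGroup (Fin 2) ℂ

instance : MeasurableSpace SU2 := borel SU2

instance : BorelSpace SU2 := ⟨rfl⟩

instance : IsTopologicalGroup SU2 where
  continuous_mul := by
    refine Continuous.subtype_mk ?_ _
    exact (continuous_subtype_val.comp continuous_fst).matrix_mul
      (continuous_subtype_val.comp continuous_snd)
  continuous_inv := by
    refine Continuous.subtype_mk ?_ _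
    exact continuous_subtype_val.matrix_conjTranspose

instance : CompactSpace SU2 := by
  refine isCompact_iff_compactSpace.mp ?_
  have hK : IsCompact (Set.univ.pi fun _ : Fin 2 => Set.univ.pi fun _ : Fin 2 =>
      Metric.closedBall (0 : ℂ) 1) :=
    isCompact_univ_pi fun _ => isCompact_univ_pi fun _ => isCompact_closedBall 0 1
  refine IsCompact.of_isClosed_subset (s := (Set.univ.pi fun _ : Fin 2 =>
    Set.univ.pi fun _ : Fin 2 => Metric.closedBall (0 : ℂ) 1 : Set (Matrix (Fin 2) (Fin 2) ℂ)))
    hK ?_ ?_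
  · have h : ((Matrix.specialUnitaryGroup (Fin 2) ℂ : Submonoid (Matrix (Fin 2) (Fin 2) ℂ)) :
        Set (Matrix (Fin 2) (Fin 2) ℂ)) = {A | A * star A = 1} ∩ {A | A.det = 1} := by
      ext A
      simp [Matrix.mem_specialUnitaryGroup_iff, Matrix.mem_unitaryGroup_iff]
    rw [h]
    refine IsClosed.inter (isClosed_eq ?_ continuous_const) (isClosed_eq ?_ continuous_const)
    · exact continuous_id.matrix_mul continuous_id.matrix_conjTranspose
    · exact continuous_id.matrix_det
  · intro A hA i _ j _
    have hu : A ∈ Matrix.unitaryGroup (Fin 2) ℂ := hA.1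
    simpa using entry_norm_bound_of_unitary hu i j

/-- The one-parameter group `{exp(i t J₃)} = {diag(e^{it/2}, e^{-it/2})}`. -/
def U1 : Subgroup SU2 where
  carrier := {g | ∃ t : ℝ, (g : Matrix (Fin 2) (Fin 2) ℂ) =
    Matrix.diagonal ![Complex.exp (Complex.I * t / 2), Complex.exp (-(Complex.I * t / 2))]}
  one_mem' := ⟨0, by
    ext a b
    fin_cases a <;> fin_cases b <;> simp⟩
  mul_mem' := by
    rintro g h ⟨s, hs⟩ ⟨t, ht⟩
    refine ⟨s + t, ?_⟩
    rw [Submonoid.coe_mul, hs, ht, Matrix.diagonal_mul_diagonal]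
    congr 1
    ext a
    fin_cases a <;> simp [← Complex.exp_add] <;> ring_nf
  inv_mem' := by
    rintro g ⟨t, ht⟩
    refine ⟨-t, ?_⟩
    rw [← Matrix.star_eq_inv, Matrix.specialUnitaryGroup.coe_star, ht,
      Matrix.star_eq_conjTranspose, Matrix.diagonal_conjTranspose]
    congr 1
    ext a
    fin_cases a <;> simp [← Complex.exp_conj, neg_div, map_ofNat]

/-- The parameter space `Θ = SU(2)/U(1)`. It carries the left action of `SU(2)` and the quotient
σ-algebra. -/
abbrev Theta : Type := SU2 ⧸ U1

/-- A representative `g(θ) ∈ SU(2)` of `θ ∈ Θ`. -/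
def rep (θ : Theta) : SU2 := Quotient.out θ

/-- The invariant probability measure on `Θ`: the image of the normalized Haar measure. -/
def nu : Measure Theta :=
  (Measure.haarMeasure (⊤ : TopologicalSpace.PositiveCompacts SU2)).map
    (QuotientGroup.mk : SU2 → Theta)

/-! ### Spin-`j` systems

Throughout `n = 2j`. The system `H_j` is `ℂ^{n+1}`, realized as the symmetric subspace of `n`
qubits. Its standard basis vector with index `i` (`0 ≤ i ≤ n`) is `|j; m⟩` with `m = j - i`,
i.e. the normalized symmetric `n`-qubit state with `i` qubits in `|1⟩ = |½; -½⟩` and `n - i` qubits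
in `|0⟩ = |½; ½⟩`. In particular the index `0` is `|j; j⟩`. -/

/-- The number of qubits in state `|1⟩` in the computational basis state `s`. -/
def weight {n : ℕ} (s : Fin n → Fin 2) : ℕ := ∑ k, (s k : ℕ)

/-- The isometry `H_j → (ℂ²)^{⊗ n}` that maps `|j; j - i⟩` to the normalized symmetric (Dicke)
state `(n choose i)^{-1/2} ∑_{weight s = i} |s⟩`. -/
def dicke (n : ℕ) : Matrix (Fin n → Fin 2) (Fin (n + 1)) ℂ :=
  Matrix.of fun s i => if weight s = i then (((Real.sqrt (n.choose i))⁻¹ : ℝ) : ℂ) else 0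

/-- The matrix of `g^{⊗ n}` in the computational basis. -/
def tensorPower (n : ℕ) (g : SU2) : Matrix (Fin n → Fin 2) (Fin n → Fin 2) ℂ :=
  Matrix.of fun s t => ∏ k, (g : Matrix (Fin 2) (Fin 2) ℂ) (s k) (t k)

/-- The spin-`j` representation `U_{j,g}`, `n = 2j`: the restriction of `g^{⊗ n}` to the symmetric
subspace, in the basis `|j; m⟩`. -/
def spinRep (n : ℕ) (g : SU2) : Matrix (Fin (n + 1)) (Fin (n + 1)) ℂ :=
  (dicke n)ᴴ * tensorPower n g * dicke n

/-- The projector `|j; j - i⟩⟨j; j - i|`. -/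
def ketBra (n : ℕ) (i : Fin (n + 1)) : Matrix (Fin (n + 1)) (Fin (n + 1)) ℂ :=
  Matrix.single i i 1

/-- The space `H_{1/2} ⊗ H_j`, `n = 2j`. -/
abbrev Coupled (n : ℕ) : Type := EuclideanSpace ℂ (Fin (1 + 1) × Fin (n + 1))

/-- The component of type `H_s` (`N = 2s`) of the representation `U_{1/2,g} ⊗ U_{j,g}` on
`H_{1/2} ⊗ H_j` (`n = 2j`): the span of the ranges of all intertwining maps from `H_s`. -/
def spinComponent (N n : ℕ) : Submodule ℂ (Coupled n) :=
  Submodule.span ℂ {w | ∃ A : Matrix (Fin (1 + 1) × Fin (n + 1)) (Fin (N + 1)) ℂ,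
    (∀ g : SU2, A * spinRep N g = (spinRep 1 g ⊗ₖ spinRep n g) * A) ∧
    ∃ v : Fin (N + 1) → ℂ, w = WithLp.toLp 2 (A *ᵥ v)}

/-- The matrix of the orthogonal projection `P_s` (`N = 2s`) of `H_{1/2} ⊗ H_j` (`n = 2j`) onto its
component `H_s`. -/
def spinProj (N n : ℕ) :
    Matrix (Fin (1 + 1) × Fin (n + 1)) (Fin (1 + 1) × Fin (n + 1)) ℂ :=
  Matrix.toEuclideanLin.symm ((spinComponent N n).starProjection : Coupled n →ₗ[ℂ] Coupled n)

/-- The number `Tr P_s (|½;½⟩⟨½;½| ⊗ ρ)`, with `N = 2s` and `n = 2j`. -/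
def couplingWeight (N n : ℕ) (ρ : Matrix (Fin (n + 1)) (Fin (n + 1)) ℂ) : ℝ :=
  (spinProj N n * (ketBra 1 0 ⊗ₖ ρ)).trace.re

/-! ### Positive operator valued measures -/

/-- A POVM on the measurable space `X`, on the Hilbert space `ℂ^ι`: a countably additive measure
with positive semidefinite values and total mass the identity. -/
structure POVM (X : Type*) [MeasurableSpace X] (ι : Type*) [Fintype ι] [DecidableEq ι] where
  /-- The underlying matrix-valued measure. -/
  meas : VectorMeasure X (Matrix ι ι ℂ)
  posSemidef : ∀ B, MeasurableSet B → (meas B).PosSemidef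
  total : meas Set.univ = 1

section Law

variable {X : Type*} [MeasurableSpace X] {ι : Type*} [Fintype ι] [DecidableEq ι]

/-- The real linear functional `A ↦ Re Tr (σ A)`. -/
def traceAgainst (σ : Matrix ι ι ℂ) : Matrix ι ι ℂ →+ ℝ where
  toFun A := (σ * A).trace.re
  map_zero' := by simp
  map_add' A B := by simp [mul_add]

theorem continuous_traceAgainst (σ : Matrix ι ι ℂ) : Continuous (traceAgainst σ) :=
  Complex.continuous_re.comp (continuous_const.matrix_mul continuous_id).matrix_trace

open scoped MatrixOrder in
theorem traceAgainst_nonneg {σ A : Matrix ι ι ℂ} (hσ : σ.PosSemidef) (hA : A.PosSemidef) :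
    0 ≤ traceAgainst σ A := by
  obtain ⟨B, rfl⟩ := CStarAlgebra.nonneg_iff_eq_star_mul_self.mp hA.nonneg
  rw [Matrix.star_eq_conjTranspose]
  have h := (hσ.mul_mul_conjTranspose_same B).trace_nonneg
  rw [Matrix.trace_mul_comm, ← Matrix.mul_assoc, Matrix.trace_mul_comm] at h
  exact (Complex.nonneg_iff.mp h).1

/-- The signed measure `B ↦ Tr (σ M(B))`. -/
def POVM.signedLaw (M : POVM X ι) (σ : Matrix ι ι ℂ) : SignedMeasure X :=
  M.meas.mapRange (traceAgainst σ) (continuous_traceAgainst σ)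

theorem POVM.signedLaw_nonneg (M : POVM X ι) {σ : Matrix ι ι ℂ} (hσ : σ.PosSemidef) :
    0 ≤[Set.univ] M.signedLaw σ := by
  rw [VectorMeasure.le_restrict_univ_iff_le]
  exact fun B hB => traceAgainst_nonneg hσ (M.posSemidef B hB)

/-- The distribution `B ↦ Tr (σ M(B))` of the outcome of the POVM `M` in the state `σ`. -/
def POVM.law (M : POVM X ι) (σ : Matrix ι ι ℂ) (hσ : σ.PosSemidef) : Measure X :=
  (M.signedLaw σ).toMeasureOfZeroLE Set.univ MeasurableSet.univ (M.signedLaw_nonneg hσ)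

end Law

/-! ### The covariant model and the performance of an estimator -/

/-- The state `ρ = ∑ₘ pₘ |j;m⟩⟨j;m|`, where `p i` is the weight of `m = j - i`. -/
def diagState {n : ℕ} (p : Fin (n + 1) → ℝ) : Matrix (Fin (n + 1)) (Fin (n + 1)) ℂ :=
  Matrix.diagonal fun i => (p i : ℂ)

/-- The state `ρ_θ = U_{j,g(θ)} ρ U_{j,g(θ)}†`. It does not depend on the choice of `g(θ)`, as `ρ` is
diagonal. -/
def modelState {n : ℕ} (p : Fin (n + 1) → ℝ) (θ : Theta) :
    Matrix (Fin (n + 1)) (Fin (n + 1)) ℂ :=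
  spinRep n (rep θ) * diagState p * (spinRep n (rep θ))ᴴ

theorem modelState_posSemidef {n : ℕ} {p : Fin (n + 1) → ℝ} (hp : ∀ i, 0 ≤ p i) (θ : Theta) :
    (modelState p θ).PosSemidef := by
  refine Matrix.PosSemidef.mul_mul_conjTranspose_same ?_ _
  exact Matrix.PosSemidef.diagonal fun i => by simpa using hp i

/-- The gain `R(θ, θ') = Tr (U_θ |½;½⟩⟨½;½| U_θ†) (U_θ' |½;½⟩⟨½;½| U_θ'†)`: the fidelity between the
spin-½ states attached to `θ` and `θ'`. -/
def gain (θ θ' : Theta) : ℝ :=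
  ((spinRep 1 (rep θ) * ketBra 1 0 * (spinRep 1 (rep θ))ᴴ) *
    (spinRep 1 (rep θ') * ketBra 1 0 * (spinRep 1 (rep θ'))ᴴ)).trace.re

/-- The average gain `∫ R(θ, θ') Tr ρ_θ M(dθ')` of the estimator `M` at the true parameter `θ`. -/
def averageGain {n : ℕ} (p : Fin (n + 1) → ℝ) (hp : ∀ i, 0 ≤ p i)
    (M : POVM Theta (Fin (n + 1))) (θ : Theta) : ℝ :=
  ∫ θ', gain θ θ' ∂(M.law (modelState p θ) (modelState_posSemidef hp θ))

/-- The worst-case average gain `R(M)`. -/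
def worstGain {n : ℕ} (p : Fin (n + 1) → ℝ) (hp : ∀ i, 0 ≤ p i)
    (M : POVM Theta (Fin (n + 1))) : ℝ :=
  ⨅ θ, averageGain p hp M θ

/-- The Bayesian average gain `R_ν(M)`. -/
def bayesGain {n : ℕ} (p : Fin (n + 1) → ℝ) (hp : ∀ i, 0 ≤ p i)
    (M : POVM Theta (Fin (n + 1))) : ℝ :=
  ∫ θ, averageGain p hp M θ ∂nu

/-- The POVM `M` is covariant: `U_{j,g} M(B) U_{j,g}† = M(gB)`. -/
def IsCovariant {n : ℕ} (M : POVM Theta (Fin (n + 1))) : Prop :=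
  ∀ (g : SU2) (B : Set Theta), MeasurableSet B →
    spinRep n g * M.meas B * (spinRep n g)ᴴ = M.meas (g • B)

/-- `M` is the POVM `M_T` generated by `T`:
`M_T(B) = (2j+1) ∫_B U_{j,g(θ)} T U_{j,g(θ)}† ν(dθ)`, the integral being taken entrywise. -/
def IsGeneratedBy {n : ℕ} (M : POVM Theta (Fin (n + 1)))
    (T : Matrix (Fin (n + 1)) (Fin (n + 1)) ℂ) : Prop :=
  ∀ B : Set Theta, MeasurableSet B → ∀ a b : Fin (n + 1),
    M.meas B a b =
      ((n : ℂ) + 1) * ∫ θ in B, (spinRep n (rep θ) * T * (spinRep n (rep θ))ᴴ) a b ∂nu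

end SpinEstimation

end

noncomputable section

namespace SpinEstimation

/-! ### Coherent vectors and the spin representations -/

/-! Let E = ∫ |θ⟩⟨θ| ⊗ M(dθ) on H_{1/2} ⊗ H_j, where |θ⟩⟨θ| is the spin-½ state attached to θ. The
gain of M at θ is linear in E: it is the trace of E against the conjugate of |½;½⟩⟨½;½| ⊗ ρ by a
representative of θ (`averageGain_eq`). Averaging over ν replaces this conjugate by its mean over
the group. By Schur's lemma the mean is a·P_{j+½} + b·P_{j-½}, where a and b are the two sides of
the hypothesis, because the summands have dimensions 2j+2 and 2j (`twirl_coupled`). All that is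
needed of E is E ≥ 0 and Tr E = 2j+1. Since a ≥ b, the Bayesian gain is at most (2j+1)a
(`bayesGain_le`), and so is the worst-case gain, an infimum being at most an average.

The bound is reached as soon as E is carried by P_{j+½}. The vector |½;½⟩ ⊗ |j;j⟩ is a highest
weight vector of H_{j+½}, so for the covariant POVM generated by |j;j⟩⟨j;j| the operator E is a
multiple of P_{j+½} (`scoreOperator_optimal`). This E commutes with the group, hence the gain does
not depend on θ and the two criteria agree.

The representation theory rests on the coherent vectors x^{⊗n}, n = 2j, which span H_j and on which
U_g acts by x ↦ gx. Schur's lemma follows by comparing weights of J₃ and noting that the orbit of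
the highest weight vector spans. For an arbitrary M, a matrix-valued Radon–Nikodym density
(`exists_isDensity`) gives a meaning to E. -/

theorem card_weight_eq (n i : ℕ) :
    (Finset.univ.filter fun s : Fin n → Fin 2 => weight s = i).card = n.choose i := by
  -- Generating function of the weight: each of the `n` factors `1 + X` chooses one bit.
  have h : ∑ s : Fin n → Fin 2, (Polynomial.X : Polynomial ℕ) ^ weight s =
      (1 + Polynomial.X) ^ n := by
    have := (Finset.prod_univ_sum (fun _ : Fin n => (Finset.univ : Finset (Fin 2)))
      (fun _ b => (Polynomial.X : Polynomial ℕ) ^ (b : ℕ))).symm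
    simpa [weight, Finset.prod_pow_eq_pow_sum, Fin.sum_univ_two] using this
  have h2 := congrArg (fun q => Polynomial.coeff q i) h
  simp only [Polynomial.finsetSum_coeff, Polynomial.coeff_X_pow,
    Polynomial.coeff_one_add_X_pow] at h2
  rw [Finset.card_filter]
  simpa [eq_comm] using h2

theorem weight_le {n : ℕ} (s : Fin n → Fin 2) : weight s ≤ n := by
  have : weight s ≤ ∑ _k : Fin n, 1 := Finset.sum_le_sum fun k _ => by omega
  simpa using this

/-- The vector `x^{⊗ n}`. -/
def productVec (n : ℕ) (x : Fin 2 → ℂ) : (Fin n → Fin 2) → ℂ := fun s => ∏ k, x (s k)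

/-- The coherent vector of `H_j`, `n = 2j`, that corresponds to `x^{⊗ n}`. -/
def coherent (n : ℕ) (x : Fin 2 → ℂ) : Fin (n + 1) → ℂ :=
  fun i => (Real.sqrt (n.choose i) : ℂ) * x 0 ^ (n - (i : ℕ)) * x 1 ^ (i : ℕ)

theorem productVec_apply {n : ℕ} (x : Fin 2 → ℂ) (s : Fin n → Fin 2) :
    productVec n x s = x 0 ^ (n - weight s) * x 1 ^ weight s := by
  have h1 : ∀ b : Fin 2, x b = x 0 ^ (1 - (b : ℕ)) * x 1 ^ (b : ℕ) := by
    intro b; fin_cases b <;> simp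
  have h2 : ∑ k, (1 - (s k : ℕ)) = n - weight s := by
    have : ∑ k, (1 - (s k : ℕ)) + weight s = n := by
      rw [weight, ← Finset.sum_add_distrib]
      have : ∀ k ∈ (Finset.univ : Finset (Fin n)), 1 - (s k : ℕ) + (s k : ℕ) = 1 := by
        intro k _; omega
      rw [Finset.sum_congr rfl this]; simp
    omega
  unfold productVec
  rw [Finset.prod_congr rfl fun k _ => h1 (s k), Finset.prod_mul_distrib,
    Finset.prod_pow_eq_pow_sum, Finset.prod_pow_eq_pow_sum, h2, weight]

theorem sqrt_choose_ne_zero {n : ℕ} (i : Fin (n + 1)) : (Real.sqrt (n.choose i) : ℂ) ≠ 0 := by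
  have : 0 < n.choose i := Nat.choose_pos (by omega)
  have h : 0 < Real.sqrt (n.choose i) := Real.sqrt_pos.mpr (by exact_mod_cast this)
  exact_mod_cast h.ne'

/-- The entry of x^{⊗n} at `s` depends on the weight of `s` alone, so x^{⊗n} is symmetric; the
square root in `coherent` cancels the Dicke normalization. -/
theorem dicke_mulVec_coherent (n : ℕ) (x : Fin 2 → ℂ) :
    dicke n *ᵥ coherent n x = productVec n x := by
  ext s
  have hlt : weight s < n + 1 := Nat.lt_succ_of_le (weight_le s)
  rw [Matrix.mulVec, dotProduct, Finset.sum_eq_single (⟨weight s, hlt⟩ : Fin (n + 1))]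
  · have := sqrt_choose_ne_zero (⟨weight s, hlt⟩ : Fin (n + 1))
    rw [productVec_apply]
    simp only [dicke, coherent, Matrix.of_apply, if_true] at this ⊢
    push_cast
    field_simp
  · intro i _ hi
    have : weight s ≠ (i : ℕ) := fun h => hi (Fin.ext h.symm)
    simp [dicke, this]
  · simp

theorem dicke_conjTranspose_mul_dicke (n : ℕ) : (dicke n)ᴴ * dicke n = 1 := by
  ext i k
  rw [Matrix.mul_apply]
  by_cases hik : i = k
  · subst hik
    have h : ∀ s : Fin n → Fin 2, (dicke n)ᴴ i s * dicke n s i =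
        if weight s = i then ((n.choose i : ℂ))⁻¹ else 0 := by
      intro s
      simp only [dicke, Matrix.conjTranspose_apply, Matrix.of_apply]
      split_ifs
      · simp only [RCLike.star_def, Complex.conj_ofReal]
        rw [← Complex.ofReal_mul, ← mul_inv, Real.mul_self_sqrt (by positivity)]
        push_cast; rfl
      · simp
    rw [Finset.sum_congr rfl fun s _ => h s, ← Finset.sum_filter, Finset.sum_const,
      card_weight_eq]
    have : (n.choose i : ℂ) ≠ 0 := by
      exact_mod_cast (Nat.choose_pos (by omega : (i : ℕ) ≤ n)).ne'
    simp [this]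
  · rw [Matrix.one_apply_ne hik]
    refine Finset.sum_eq_zero fun s _ => ?_
    simp only [dicke, Matrix.conjTranspose_apply, Matrix.of_apply]
    have : (i : ℕ) ≠ k := fun h => hik (Fin.ext h)
    split_ifs with h1 h2 <;> simp_all

theorem tensorPower_mulVec_productVec (n : ℕ) (g : SU2) (x : Fin 2 → ℂ) :
    tensorPower n g *ᵥ productVec n x = productVec n (g.1 *ᵥ x) := by
  ext s
  simp only [Matrix.mulVec, dotProduct, tensorPower, productVec, Matrix.of_apply,
    ← Finset.prod_mul_distrib]
  rw [Finset.prod_univ_sum]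
  simp

/-- The spin representation permutes the coherent vectors. -/
theorem spinRep_mulVec_coherent (n : ℕ) (g : SU2) (x : Fin 2 → ℂ) :
    spinRep n g *ᵥ coherent n x = coherent n (g.1 *ᵥ x) := by
  rw [spinRep, ← Matrix.mulVec_mulVec, dicke_mulVec_coherent, ← Matrix.mulVec_mulVec,
    tensorPower_mulVec_productVec, ← dicke_mulVec_coherent, Matrix.mulVec_mulVec,
    dicke_conjTranspose_mul_dicke, Matrix.one_mulVec]

/-- The coherent vectors `coherent n (1, z)` span: a matrix that kills all of them vanishes. -/
theorem eq_zero_of_mulVec_coherent {n : ℕ} {ι : Type*} {T : Matrix ι (Fin (n + 1)) ℂ}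
    (h : ∀ z : ℂ, T *ᵥ coherent n ![1, z] = 0) : T = 0 := by
  ext k i
  -- Row `k` applied to the coherent vector of (1, z) is a polynomial in z whose coefficients are
  -- the entries of the row up to nonzero factors. It vanishes at every z.
  set q : Polynomial ℂ := ∑ i : Fin (n + 1),
    Polynomial.C (T k i * (Real.sqrt (n.choose i) : ℂ)) * Polynomial.X ^ (i : ℕ) with hq
  have h0 : q = 0 := by
    refine Polynomial.funext fun z => ?_
    have := congrFun (h z) k
    simp only [Matrix.mulVec, dotProduct, coherent, Pi.zero_apply] at this
    rw [hq, Polynomial.eval_finsetSum, Polynomial.eval_zero, ← this]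
    refine Finset.sum_congr rfl fun i _ => ?_
    simp [mul_assoc]
  have h1 := congrArg (fun q => Polynomial.coeff q i) h0
  simp only [hq, Polynomial.finsetSum_coeff, Polynomial.coeff_C_mul_X_pow,
    Polynomial.coeff_zero] at h1
  rw [Finset.sum_eq_single i] at h1
  · simpa [sqrt_choose_ne_zero i] using h1
  · intro b _ hb
    have : (i : ℕ) ≠ b := fun h => hb (Fin.ext h.symm)
    simp [this]
  · simp

theorem eq_of_mulVec_coherent {n : ℕ} {ι : Type*} {S T : Matrix ι (Fin (n + 1)) ℂ}
    (h : ∀ x, S *ᵥ coherent n x = T *ᵥ coherent n x) : S = T := by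
  refine sub_eq_zero.mp (eq_zero_of_mulVec_coherent fun z => ?_)
  rw [Matrix.sub_mulVec, h, sub_self]

theorem spinRep_one (n : ℕ) : spinRep n 1 = 1 :=
  eq_of_mulVec_coherent fun x => by
    rw [spinRep_mulVec_coherent]; simp

/-- Not formal from the definition: `dicke n * (dicke n)ᴴ` is only the projection onto the symmetric
subspace. Testing on coherent vectors avoids showing that g^{⊗n} commutes with it. -/
theorem spinRep_mul (n : ℕ) (g h : SU2) : spinRep n (g * h) = spinRep n g * spinRep n h :=
  eq_of_mulVec_coherent fun x => by
    rw [← Matrix.mulVec_mulVec, spinRep_mulVec_coherent, spinRep_mulVec_coherent,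
      spinRep_mulVec_coherent, Submonoid.coe_mul, Matrix.mulVec_mulVec]

theorem spinRep_conjTranspose (n : ℕ) (g : SU2) : (spinRep n g)ᴴ = spinRep n g⁻¹ := by
  have h : (tensorPower n g)ᴴ = tensorPower n g⁻¹ := by
    ext s t
    rw [← Matrix.star_eq_inv]
    simp [tensorPower, Matrix.star_apply]
  rw [spinRep, Matrix.conjTranspose_mul, Matrix.conjTranspose_mul,
    Matrix.conjTranspose_conjTranspose, h, ← Matrix.mul_assoc]
  rfl

theorem continuous_spinRep (n : ℕ) : Continuous (spinRep n) := by
  have h : Continuous (tensorPower n) := by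
    refine continuous_matrix fun s t => ?_
    simp only [tensorPower, Matrix.of_apply]
    exact continuous_finsetProd (f := fun k (g : SU2) => g.1 (s k) (t k)) _
      fun k _ => continuous_subtype_val.matrix_elem _ _
  exact (continuous_const.matrix_mul h).matrix_mul continuous_const

/-- A finite-dimensional continuous unitary matrix representation of `SU(2)`. -/
structure UnitaryRep (ι : Type*) [Fintype ι] [DecidableEq ι] where
  /-- The representing matrices. -/
  toFun : SU2 → Matrix ι ι ℂ
  map_one : toFun 1 = 1
  map_mul : ∀ g h, toFun (g * h) = toFun g * toFun h
  conjTranspose : ∀ g, (toFun g)ᴴ = toFun g⁻¹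
  continuous : Continuous toFun

/-- The spin representation on `H_j`, `n = 2j`. -/
def spin (n : ℕ) : UnitaryRep (Fin (n + 1)) :=
  ⟨spinRep n, spinRep_one n, spinRep_mul n, spinRep_conjTranspose n, continuous_spinRep n⟩

/-- The tensor product of two representations. -/
def UnitaryRep.tensor {ι κ : Type*} [Fintype ι] [DecidableEq ι] [Fintype κ] [DecidableEq κ]
    (π : UnitaryRep ι) (σ : UnitaryRep κ) : UnitaryRep (ι × κ) where
  toFun g := π.toFun g ⊗ₖ σ.toFun g
  map_one := by rw [π.map_one, σ.map_one, Matrix.one_kronecker_one]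
  map_mul g h := by rw [π.map_mul, σ.map_mul, Matrix.mul_kronecker_mul]
  conjTranspose g := by rw [Matrix.conjTranspose_kronecker, π.conjTranspose, σ.conjTranspose]
  continuous := continuous_matrix fun i j =>
    (π.continuous.matrix_elem _ _).mul (σ.continuous.matrix_elem _ _)

/-! ### Intertwining maps -/

section Intertwiner

variable {ι κ μ : Type*} [Fintype ι] [DecidableEq ι] [Fintype κ] [DecidableEq κ]
  [Fintype μ] [DecidableEq μ]

/-- `T` intertwines the representation `π` with the representation `σ`. -/
def Intertwines (π : UnitaryRep ι) (σ : UnitaryRep κ) (T : Matrix κ ι ℂ) : Prop :=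
  ∀ g, T * π.toFun g = σ.toFun g * T

variable {π : UnitaryRep ι} {σ : UnitaryRep κ} {τ : UnitaryRep μ}

theorem Intertwines.conjTranspose {T : Matrix κ ι ℂ} (h : Intertwines π σ T) :
    Intertwines σ π Tᴴ := by
  intro g
  have := congrArg Matrix.conjTranspose (h g⁻¹)
  rw [Matrix.conjTranspose_mul, Matrix.conjTranspose_mul, π.conjTranspose, σ.conjTranspose,
    inv_inv] at this
  exact this.symm

theorem Intertwines.mul {T : Matrix κ ι ℂ} {S : Matrix μ κ ℂ} (hS : Intertwines σ τ S)
    (hT : Intertwines π σ T) : Intertwines π τ (S * T) := by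
  intro g
  rw [Matrix.mul_assoc, hT g, ← Matrix.mul_assoc, hS g, Matrix.mul_assoc]

end Intertwiner

/-! ### Schur's lemma -/

/-- The element `diag(e^{it/2}, e^{-it/2})` of `SU(2)`. -/
def torus (t : ℝ) : SU2 :=
  ⟨Matrix.diagonal ![Complex.exp (Complex.I * t / 2), Complex.exp (-(Complex.I * t / 2))], by
    rw [Matrix.mem_specialUnitaryGroup_iff, Matrix.mem_unitaryGroup_iff,
      Matrix.star_eq_conjTranspose, Matrix.diagonal_conjTranspose, Matrix.diagonal_mul_diagonal]
    constructor
    · rw [← Matrix.diagonal_one]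
      congr 1
      ext a
      fin_cases a <;> simp [← Complex.exp_conj, ← Complex.exp_add, map_ofNat, neg_div]
    · rw [Matrix.det_diagonal]
      simp [← Complex.exp_add]⟩

theorem spinRep_torus (n : ℕ) (t : ℝ) : spinRep n (torus t) =
    Matrix.diagonal fun i : Fin (n + 1) =>
      Complex.exp (Complex.I * t * ((n : ℂ) - 2 * (i : ℂ)) / 2) := by
  refine eq_of_mulVec_coherent fun x => ?_
  rw [spinRep_mulVec_coherent]
  ext i
  have hi : (i : ℕ) ≤ n := by omega
  simp only [torus, coherent, Matrix.mulVec_diagonal, Matrix.cons_val_zero, Matrix.cons_val_one]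
  have : Complex.exp (Complex.I * t * ((n : ℂ) - 2 * (i : ℂ)) / 2) =
      Complex.exp (Complex.I * t / 2) ^ (n - (i : ℕ)) *
        Complex.exp (-(Complex.I * t / 2)) ^ (i : ℕ) := by
    rw [← Complex.exp_nat_mul, ← Complex.exp_nat_mul, ← Complex.exp_add, Nat.cast_sub hi]
    congr 1
    ring
  rw [this, mul_pow, mul_pow]
  ring

theorem exists_torus_of_mem_U1 {u : SU2} (hu : u ∈ U1) : ∃ t, u = torus t := by
  obtain ⟨t, ht⟩ := hu
  exact ⟨t, Subtype.ext ht⟩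

/-- An intertwiner commutes with the torus, so it can only connect basis vectors with the same
eigenvalue of J₃; the weights are doubled here to stay integral. -/
theorem weight_eq_of_intertwines {N M : ℕ} {T : Matrix (Fin (M + 1)) (Fin (N + 1)) ℂ}
    (hT : Intertwines (spin N) (spin M) T) {k : Fin (M + 1)} {i : Fin (N + 1)}
    (h : T k i ≠ 0) : (N : ℤ) - 2 * i = M - 2 * k := by
  by_contra hne
  set d : ℤ := ((N : ℤ) - 2 * i) - (M - 2 * k) with hd
  have hd0 : (d : ℂ) ≠ 0 := by
    have : d ≠ 0 := sub_ne_zero.mpr hne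
    exact_mod_cast this
  have hdR : (d : ℝ) ≠ 0 := by exact_mod_cast hd0
  -- At t = 2π/d the two characters differ by exp(i t d/2) = -1, so they cannot agree.
  have := congrFun (congrFun (hT (torus (2 * Real.pi / d))) k) i
  simp only [spin, spinRep_torus, Matrix.mul_diagonal, Matrix.diagonal_mul] at this
  have h1 := mul_left_cancel₀ h (this.trans (mul_comm _ _))
  have h2 : Complex.I * ((2 * Real.pi / d : ℝ) : ℂ) * ((N : ℂ) - 2 * (i : ℂ)) / 2 =
      Complex.I * ((2 * Real.pi / d : ℝ) : ℂ) * ((M : ℂ) - 2 * (k : ℂ)) / 2 +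
        Real.pi * Complex.I := by
    have h3 : (N : ℂ) - 2 * (i : ℂ) = (M : ℂ) - 2 * (k : ℂ) + d := by
      rw [hd]; push_cast; ring
    rw [h3]
    push_cast
    field_simp
  rw [h2, Complex.exp_add, Complex.exp_pi_mul_I] at h1
  have h4 := Complex.exp_ne_zero
    (Complex.I * ((2 * Real.pi / d : ℝ) : ℂ) * ((M : ℂ) - 2 * (k : ℂ)) / 2)
  have h5 : Complex.exp
    (Complex.I * ((2 * Real.pi / d : ℝ) : ℂ) * ((M : ℂ) - 2 * (k : ℂ)) / 2) = 0 := by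
    linear_combination (-1 / 2) * h1
  exact h4 h5

/-- An intertwiner between spin spaces that kills the highest weight vector vanishes. -/
theorem eq_zero_of_intertwines {N M : ℕ} {T : Matrix (Fin (M + 1)) (Fin (N + 1)) ℂ}
    (hT : Intertwines (spin N) (spin M) T) (h0 : ∀ k, T k 0 = 0) : T = 0 := by
  have he : T *ᵥ coherent N ![1, 0] = 0 := by
    ext k
    rw [Matrix.mulVec, dotProduct, Finset.sum_eq_single 0]
    · simp [h0]
    · intro i _ hi
      have : (i : ℕ) ≠ 0 := fun h => hi (Fin.ext h)
      simp [coherent, this]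
    · simp
  refine eq_zero_of_mulVec_coherent fun z => ?_
  -- The first column of `A` is the unit vector (1, z)/r. Hence the coherent vector of (1, z) is r^N
  -- times the image of the highest weight vector under a group element, and `T` kills it too.
  set r : ℝ := Real.sqrt (1 + ‖z‖ ^ 2) with hr
  have hr0 : 0 < r := Real.sqrt_pos.mpr (by positivity)
  have hrc : (r : ℂ) ≠ 0 := by exact_mod_cast hr0.ne'
  have hrr : (r : ℂ) * r = 1 + z * (starRingEnd ℂ) z := by
    rw [Complex.mul_conj, ← Complex.ofReal_mul, hr, Real.mul_self_sqrt (by positivity),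
      Complex.normSq_eq_norm_sq]
    push_cast; rfl
  set A : Matrix (Fin 2) (Fin 2) ℂ :=
    !![(r : ℂ)⁻¹, -(starRingEnd ℂ) z * (r : ℂ)⁻¹; z * (r : ℂ)⁻¹, (r : ℂ)⁻¹] with hA
  have hmem : A ∈ Matrix.specialUnitaryGroup (Fin 2) ℂ := by
    rw [Matrix.mem_specialUnitaryGroup_iff, Matrix.mem_unitaryGroup_iff]
    constructor
    · ext a b
      fin_cases a <;> fin_cases b <;>
        simp [hA, Matrix.mul_apply, Fin.sum_univ_two, Matrix.star_apply] <;> field_simp <;>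
        first | ring1 | linear_combination -hrr
    · simp [hA, Matrix.det_fin_two]
      field_simp
      linear_combination -hrr
  have hz : coherent N ![1, z] = (r : ℂ) ^ N • coherent N (A *ᵥ ![1, 0]) := by
    ext i
    have hi : (i : ℕ) ≤ N := by omega
    have hp : (r : ℂ) ^ N = (r : ℂ) ^ (N - (i : ℕ)) * (r : ℂ) ^ (i : ℕ) := by
      rw [← pow_add]; congr 1; omega
    simp only [coherent, hA, Pi.smul_apply, smul_eq_mul, hp]
    simp [mul_pow]
    field_simp
  rw [hz, Matrix.mulVec_smul, show A = (⟨A, hmem⟩ : SU2).1 from rfl, ← spinRep_mulVec_coherent,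
    Matrix.mulVec_mulVec]
  have := hT ⟨A, hmem⟩
  simp only [spin] at this
  rw [this, ← Matrix.mulVec_mulVec, he, Matrix.mulVec_zero, smul_zero]

/-- Spin representations of different spin are disjoint. -/
theorem intertwines_eq_zero {N M : ℕ} (hNM : N ≠ M) {T : Matrix (Fin (M + 1)) (Fin (N + 1)) ℂ}
    (hT : Intertwines (spin N) (spin M) T) : T = 0 := by
  -- The highest weight of the larger spin does not occur in the smaller one. The opposite
  -- inequality is reduced to this by taking adjoints.
  have key : ∀ {N M : ℕ} {T : Matrix (Fin (M + 1)) (Fin (N + 1)) ℂ}, M < N →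
      Intertwines (spin N) (spin M) T → T = 0 := by
    intro N M T hlt hT
    refine eq_zero_of_intertwines hT fun k => ?_
    by_contra hk
    have := weight_eq_of_intertwines hT hk
    simp at this
    omega
  rcases hNM.lt_or_gt with h | h
  · have := key h hT.conjTranspose
    simpa using congrArg Matrix.conjTranspose this
  · exact key h hT

/-- Spin representations are irreducible. -/
theorem intertwines_eq_smul_one {N : ℕ} {T : Matrix (Fin (N + 1)) (Fin (N + 1)) ℂ}
    (hT : Intertwines (spin N) (spin N) T) : T = T 0 0 • 1 := by
  -- The highest weight is simple, so the highest weight vector is an eigenvector of `T`;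
  -- subtracting its eigenvalue leaves an intertwiner that kills it.
  refine sub_eq_zero.mp (eq_zero_of_intertwines (N := N) (M := N) ?_ fun k => ?_)
  · intro g
    rw [Matrix.sub_mul, Matrix.mul_sub, hT g]
    simp
  · by_cases hk : k = 0
    · simp [hk]
    · have : T k 0 = 0 := by
        by_contra h
        have := weight_eq_of_intertwines hT h
        have hk' : (k : ℕ) ≠ 0 := fun h => hk (Fin.ext h)
        simp at this
        omega
      simp [this, hk]

/-! ### The Clebsch–Gordan decomposition of `H_{1/2} ⊗ H_j` -/

theorem kronecker_mulVec_prod {ι κ : Type*} [Fintype ι] [Fintype κ] (A : Matrix ι ι ℂ)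
    (B : Matrix κ κ ℂ) (u : ι → ℂ) (v : κ → ℂ) :
    ((A ⊗ₖ B) *ᵥ fun y => u y.1 * v y.2) = fun y => (A *ᵥ u) y.1 * (B *ᵥ v) y.2 := by
  ext y
  simp only [Matrix.mulVec, dotProduct, Matrix.kroneckerMap_apply, Fintype.sum_prod_type,
    Finset.sum_mul_sum]
  refine Finset.sum_congr rfl fun i _ => Finset.sum_congr rfl fun k _ => ?_
  ring

/-- The vectors `coherent a y ⊗ coherent b x` span. -/
theorem eq_of_mulVec_coherent_prod {a b : ℕ} {κ : Type*}
    {S T : Matrix κ (Fin (a + 1) × Fin (b + 1)) ℂ}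
    (h : ∀ y x, (S *ᵥ fun p => coherent a y p.1 * coherent b x p.2) =
      T *ᵥ fun p => coherent a y p.1 * coherent b x p.2) : S = T := by
  ext k ⟨i, l⟩
  -- With `y` fixed, the contraction over the first factor is a matrix on H_b, and coherent vectors
  -- separate such matrices; the first factor is treated in the same way afterwards.
  have h1 : ∀ y, (Matrix.of fun k l => ∑ i, S k (i, l) * coherent a y i) =
      Matrix.of fun k l => ∑ i, T k (i, l) * coherent a y i := by
    intro y
    refine eq_of_mulVec_coherent fun x => ?_
    ext k
    have := congrFun (h y x) k
    simp only [Matrix.mulVec, dotProduct, Fintype.sum_prod_type_right] at this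
    simpa [Matrix.mulVec, dotProduct, Finset.sum_mul, mul_assoc] using this
  have h2 : (Matrix.of fun k i => S k (i, l)) = Matrix.of fun k i => T k (i, l) := by
    refine eq_of_mulVec_coherent fun y => ?_
    ext k
    simpa [Matrix.mulVec, dotProduct] using congrFun (congrFun (h1 y) k) l
  exact congrFun (congrFun h2 k) i

/-- The representation `U_{1/2} ⊗ U_j`, `n = 2j`. -/
def coupled (n : ℕ) : UnitaryRep (Fin (1 + 1) × Fin (n + 1)) := (spin 1).tensor (spin n)

/-- The Clebsch–Gordan isometry `H_{j+1/2} → H_{1/2} ⊗ H_j`, `n = 2j`. -/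
def cgPlus (n : ℕ) : Matrix (Fin (1 + 1) × Fin (n + 1)) (Fin (n + 1 + 1)) ℂ :=
  Matrix.of fun p i =>
    if p.1 = 0 then
      if i = p.2.castSucc then (Real.sqrt (((n + 1 - p.2 : ℕ) : ℝ) / (n + 1 : ℕ)) : ℂ) else 0
    else if i = p.2.succ then (Real.sqrt (((p.2 + 1 : ℕ) : ℝ) / (n + 1 : ℕ)) : ℂ) else 0

/-- The Clebsch–Gordan isometry `H_{j-1/2} → H_{1/2} ⊗ H_j`, `m + 1 = 2j`. -/
def cgMinus (m : ℕ) : Matrix (Fin (1 + 1) × Fin (m + 1 + 1)) (Fin (m + 1)) ℂ :=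
  Matrix.of fun p i =>
    if p.1 = 0 then
      if p.2 = i.succ then (-Real.sqrt (((i + 1 : ℕ) : ℝ) / (m + 2 : ℕ)) : ℂ) else 0
    else
      if p.2 = i.castSucc then (Real.sqrt (((m + 1 - i : ℕ) : ℝ) / (m + 2 : ℕ)) : ℂ) else 0

theorem sqrt_div_mul_sqrt {a b c d : ℕ} (hb : b ≠ 0) (h : a * c = b * d) :
    (Real.sqrt ((a : ℝ) / b) : ℂ) * (Real.sqrt c : ℂ) = (Real.sqrt d : ℂ) := by
  rw [← Complex.ofReal_mul, ← Real.sqrt_mul (by positivity)]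
  congr 2
  have hb' : (b : ℝ) ≠ 0 := by exact_mod_cast hb
  have : (a : ℝ) * c = b * d := by exact_mod_cast h
  field_simp
  linarith

theorem sqrt_div_mul_sqrt' {a b c a' c' : ℕ} (h : a * c = a' * c') :
    (Real.sqrt ((a : ℝ) / b) : ℂ) * (Real.sqrt c : ℂ) =
      (Real.sqrt ((a' : ℝ) / b) : ℂ) * (Real.sqrt c' : ℂ) := by
  rw [← Complex.ofReal_mul, ← Real.sqrt_mul (by positivity), ← Complex.ofReal_mul,
    ← Real.sqrt_mul (by positivity), div_mul_eq_mul_div, div_mul_eq_mul_div]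
  have : (a : ℝ) * c = a' * c' := by exact_mod_cast h
  rw [this]

/-- This is x^{⊗(n+1)} = x ⊗ x^{⊗n} in Dicke coordinates: `cgPlus` is the inclusion of the symmetric
subspace of n+1 qubits. The coefficients match by (n+1-k)·C(n+1,k) = (n+1)·C(n,k) =
(k+1)·C(n+1,k+1). -/
theorem cgPlus_mulVec_coherent (n : ℕ) (x : Fin 2 → ℂ) :
    cgPlus n *ᵥ coherent (n + 1) x = fun p => coherent 1 x p.1 * coherent n x p.2 := by
  ext ⟨a, k⟩
  have hk : (k : ℕ) ≤ n := by omega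
  fin_cases a
  · have h1 := sqrt_div_mul_sqrt (a := n + 1 - k) (b := n + 1) (c := (n + 1).choose k)
      (d := n.choose k) (by omega) (by rw [mul_comm, ← Nat.choose_mul_succ_eq, mul_comm])
    have h2 : n + 1 - (k : ℕ) = (n - k) + 1 := by omega
    simp only [cgPlus, Matrix.mulVec, dotProduct, Matrix.of_apply, coherent]
    simp only [Fin.zero_eta, if_true, ite_mul, zero_mul, Finset.sum_ite_eq', Finset.mem_univ, Fin.val_castSucc]
    rw [mul_assoc, ← mul_assoc, ← mul_assoc, h1, h2]
    simp
    ring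
  · have h1 := sqrt_div_mul_sqrt (a := k + 1) (b := n + 1) (c := (n + 1).choose (k + 1))
      (d := n.choose k) (by omega) (by rw [Nat.add_one_mul_choose_eq, mul_comm])
    have h2 : n + 1 - ((k : ℕ) + 1) = n - k := by omega
    simp only [cgPlus, Matrix.mulVec, dotProduct, Matrix.of_apply, coherent]
    simp only [Fin.mk_one, one_ne_zero, if_false, ite_mul, zero_mul, Finset.sum_ite_eq', Finset.mem_univ, Fin.val_succ, if_true]
    rw [mul_assoc, ← mul_assoc, ← mul_assoc, h1, h2]
    simp
    ring

theorem cgPlus_intertwines (n : ℕ) : Intertwines (spin (n + 1)) (coupled n) (cgPlus n) := by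
  intro g
  refine eq_of_mulVec_coherent fun x => ?_
  simp only [coupled, UnitaryRep.tensor, spin]
  rw [← Matrix.mulVec_mulVec, ← Matrix.mulVec_mulVec, spinRep_mulVec_coherent,
    cgPlus_mulVec_coherent, cgPlus_mulVec_coherent, kronecker_mulVec_prod,
    spinRep_mulVec_coherent, spinRep_mulVec_coherent]

/-- The adjoint contracts one factor x with y through the antisymmetric form, a singlet. This form
is invariant under matrices of determinant 1, which is why the adjoint is the convenient map to
evaluate. -/
theorem cgMinus_conjTranspose_mulVec_coherent (m : ℕ) (y x : Fin 2 → ℂ) :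
    ((cgMinus m)ᴴ *ᵥ fun p => coherent 1 y p.1 * coherent (m + 1) x p.2) =
      ((Real.sqrt (((m + 1 : ℕ) : ℝ) / (m + 2 : ℕ)) : ℂ) * (x 0 * y 1 - x 1 * y 0)) •
        coherent m x := by
  ext i
  have hi : (i : ℕ) ≤ m := by omega
  have h1 := sqrt_div_mul_sqrt' (a := i + 1) (b := m + 2) (c := (m + 1).choose (i + 1))
    (a' := m + 1) (c' := m.choose i) (by rw [Nat.add_one_mul_choose_eq, mul_comm])
  have h2 := sqrt_div_mul_sqrt' (a := m + 1 - i) (b := m + 2) (c := (m + 1).choose i)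
    (a' := m + 1) (c' := m.choose i) (by rw [mul_comm, ← Nat.choose_mul_succ_eq, mul_comm])
  have h3 : m + 1 - (i : ℕ) = (m - i) + 1 := by omega
  have h4 : m + 1 - ((i : ℕ) + 1) = m - i := by omega
  have e0 : coherent 1 y 0 = y 0 := by simp [coherent]
  have e1 : coherent 1 y 1 = y 1 := by simp [coherent]
  simp only [Matrix.mulVec, dotProduct, Fintype.sum_prod_type, Matrix.conjTranspose_apply,
    cgMinus, Matrix.of_apply]
  rw [Fin.sum_univ_two]
  simp only [if_true, one_ne_zero, if_false, apply_ite star, star_zero, ite_mul, zero_mul,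
    Finset.sum_ite_eq', Finset.mem_univ, e0, e1, star_neg, RCLike.star_def,
    Complex.conj_ofReal, Pi.smul_apply, smul_eq_mul]
  simp only [coherent, Fin.val_succ, Fin.val_castSucc]
  rw [h4]
  have h5 : x 0 ^ (m + 1 - (i : ℕ)) = x 0 ^ (m - (i : ℕ)) * x 0 := by rw [h3, pow_succ]
  rw [h5]
  linear_combination (-y 0 * x 0 ^ (m - (i : ℕ)) * x 1 ^ ((i : ℕ) + 1)) * h1 +
    (y 1 * x 0 ^ (m - (i : ℕ)) * x 0 * x 1 ^ (i : ℕ)) * h2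

theorem cgMinus_intertwines (m : ℕ) : Intertwines (spin m) (coupled (m + 1)) (cgMinus m) := by
  rw [← Matrix.conjTranspose_conjTranspose (cgMinus m)]
  refine Intertwines.conjTranspose fun g => eq_of_mulVec_coherent_prod fun y x => ?_
  simp only [coupled, UnitaryRep.tensor, spin]
  rw [← Matrix.mulVec_mulVec, ← Matrix.mulVec_mulVec, kronecker_mulVec_prod,
    spinRep_mulVec_coherent, spinRep_mulVec_coherent, cgMinus_conjTranspose_mulVec_coherent,
    cgMinus_conjTranspose_mulVec_coherent, Matrix.mulVec_smul, spinRep_mulVec_coherent]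
  congr 2
  have hdet : g.1 0 0 * g.1 1 1 - g.1 0 1 * g.1 1 0 = 1 := by
    rw [← Matrix.det_fin_two]
    exact (Matrix.mem_specialUnitaryGroup_iff.mp g.2).2
  simp only [Matrix.mulVec, dotProduct, Fin.sum_univ_two]
  linear_combination (x 0 * y 1 - x 1 * y 0) * hdet

/-- By Schur's lemma the product is a scalar, so its corner entry decides. -/
theorem cgPlus_isometry (n : ℕ) : (cgPlus n)ᴴ * cgPlus n = 1 := by
  have h := intertwines_eq_smul_one ((cgPlus_intertwines n).conjTranspose.mul
    (cgPlus_intertwines n))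
  have h0 : ((cgPlus n)ᴴ * cgPlus n) 0 0 = 1 := by
    rw [Matrix.mul_apply, Fintype.sum_prod_type, Fin.sum_univ_two]
    have h1 : ∀ k : Fin (n + 1), (0 = k.castSucc) = (k = 0) := fun k => by
      rw [eq_comm (a := (0 : Fin (n + 1 + 1))), Fin.castSucc_eq_zero_iff]
    have h2 : ∀ k : Fin (n + 1), (0 = k.succ) = False := fun k => by
      simp [(Fin.succ_ne_zero k).symm]
    have h3 : (n : ℝ) + 1 ≠ 0 := by exact_mod_cast n.succ_ne_zero
    simp [cgPlus, h1, h2, div_self h3]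
  rw [h, h0, one_smul]

theorem cgMinus_isometry (m : ℕ) : (cgMinus m)ᴴ * cgMinus m = 1 := by
  have h := intertwines_eq_smul_one ((cgMinus_intertwines m).conjTranspose.mul
    (cgMinus_intertwines m))
  have h0 : ((cgMinus m)ᴴ * cgMinus m) 0 0 = 1 := by
    rw [Matrix.mul_apply, Fintype.sum_prod_type, Fin.sum_univ_two]
    have h1 : (Real.sqrt ((m : ℝ) + 2))⁻¹ * (Real.sqrt ((m : ℝ) + 2))⁻¹ +
        Real.sqrt (((m : ℝ) + 1) / (m + 2)) * Real.sqrt (((m : ℝ) + 1) / (m + 2)) = 1 := by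
      rw [← mul_inv, Real.mul_self_sqrt (by positivity), Real.mul_self_sqrt (by positivity)]
      field_simp
      ring
    simp [cgMinus]
    exact_mod_cast h1
  rw [h, h0, one_smul]

theorem cgPlus_conjTranspose_mul_cgMinus (m : ℕ) : (cgPlus (m + 1))ᴴ * cgMinus m = 0 :=
  intertwines_eq_zero (by omega)
    ((cgPlus_intertwines (m + 1)).conjTranspose.mul (cgMinus_intertwines m))

theorem cgMinus_conjTranspose_mul_cgPlus (m : ℕ) : (cgMinus m)ᴴ * cgPlus (m + 1) = 0 :=
  intertwines_eq_zero (by omega)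
    ((cgMinus_intertwines m).conjTranspose.mul (cgPlus_intertwines (m + 1)))

theorem cg_complete (m : ℕ) :
    cgPlus (m + 1) * (cgPlus (m + 1))ᴴ + cgMinus m * (cgMinus m)ᴴ = 1 := by
  have h : Matrix.fromRows (cgPlus (m + 1))ᴴ (cgMinus m)ᴴ *
      Matrix.fromCols (cgPlus (m + 1)) (cgMinus m) = 1 := by
    rw [Matrix.fromRows_mul_fromCols, cgPlus_isometry, cgMinus_isometry,
      cgPlus_conjTranspose_mul_cgMinus, cgMinus_conjTranspose_mul_cgPlus, Matrix.fromBlocks_one]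
  rw [← Matrix.fromCols_mul_fromRows]
  -- The block matrix of both embeddings is square, since 2(m+2) = (m+3) + (m+1), so a one-sided
  -- inverse is two-sided.
  refine (Matrix.mul_eq_one_comm_of_card_eq _ _ _ ?_).mp h
  simp only [Fintype.card_sum, Fintype.card_prod, Fintype.card_fin]
  omega

/-! ### The projections onto the summands -/

/-- `huniq` says that the range of every intertwiner from H_s lies in the range of `V`, so the
isotypic component is that range. The identity is checked through the characterization of the
orthogonal projection by its residual. -/
theorem spinProj_eq {N n : ℕ} {V : Matrix (Fin (1 + 1) × Fin (n + 1)) (Fin (N + 1)) ℂ}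
    (hV : Intertwines (spin N) (coupled n) V) (huniq : ∀ A, Intertwines (spin N) (coupled n) A → V * Vᴴ * A = A) :
    spinProj N n = V * Vᴴ := by
  rw [spinProj, LinearEquiv.symm_apply_eq]
  refine LinearMap.ext fun w => ?_
  refine Submodule.eq_starProjection_of_mem_of_inner_eq_zero (K := spinComponent N n)
    ?_ fun u hu => ?_
  · refine Submodule.subset_span ⟨V, hV, Vᴴ *ᵥ w.ofLp, ?_⟩
    rw [Matrix.toLpLin_apply, Matrix.mulVec_mulVec]
  · induction hu using Submodule.span_induction with
    | mem u hu =>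
      obtain ⟨A, hA, v, rfl⟩ := hu
      rw [EuclideanSpace.inner_eq_star_dotProduct]
      have hP : (V * Vᴴ)ᴴ = V * Vᴴ := by simp
      rw [WithLp.ofLp_sub, star_sub, Matrix.toLpLin_apply, Matrix.star_mulVec, hP,
        dotProduct_sub, dotProduct_comm, dotProduct_comm _ (star w.ofLp ᵥ* _),
        ← Matrix.dotProduct_mulVec, Matrix.mulVec_mulVec, huniq A hA, sub_self]
    | zero => simp
    | add x y _ _ hx hy => rw [inner_add_right, hx, hy, add_zero]
    | smul c x _ hx => rw [inner_smul_right, hx, mul_zero]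

/-- An intertwiner from H_{j+½} has no component in H_{j-½}, the two being disjoint; completeness
then puts its range inside that of `cgPlus`. -/
theorem spinProj_plus (m : ℕ) :
    spinProj (m + 1 + 1) (m + 1) = cgPlus (m + 1) * (cgPlus (m + 1))ᴴ := by
  refine spinProj_eq (cgPlus_intertwines _) fun A hA => ?_
  have h : (cgMinus m)ᴴ * A = 0 :=
    intertwines_eq_zero (by omega) ((cgMinus_intertwines m).conjTranspose.mul hA)
  have := congrArg (· * A) (cg_complete m)
  simpa [Matrix.add_mul, Matrix.mul_assoc, h] using this

theorem spinProj_minus (m : ℕ) : spinProj m (m + 1) = cgMinus m * (cgMinus m)ᴴ := by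
  refine spinProj_eq (cgMinus_intertwines _) fun A hA => ?_
  have h : (cgPlus (m + 1))ᴴ * A = 0 :=
    intertwines_eq_zero (by omega) ((cgPlus_intertwines (m + 1)).conjTranspose.mul hA)
  have := congrArg (· * A) (cg_complete m)
  simpa [Matrix.add_mul, Matrix.mul_assoc, h] using this

/-! ### Averages over the group -/

section MatrixIntegral

variable {α ι κ μ' : Type*} [MeasurableSpace α]

/-- The entrywise integral of a matrix-valued function. -/
def matrixIntegral (μ : Measure α) (f : α → Matrix κ ι ℂ) : Matrix κ ι ℂ :=
  Matrix.of fun a b => ∫ x, f x a b ∂μ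

/-- Entrywise integrability of a matrix-valued function. -/
def MatrixIntegrable (μ : Measure α) (f : α → Matrix κ ι ℂ) : Prop :=
  ∀ a b, Integrable (fun x => f x a b) μ

variable {μ : Measure α} {f : α → Matrix κ ι ℂ}

theorem matrixIntegral_const_mul [Fintype κ] (hf : MatrixIntegrable μ f) (A : Matrix μ' κ ℂ) :
    matrixIntegral μ (fun x => A * f x) = A * matrixIntegral μ f := by
  ext a b
  simp only [matrixIntegral, Matrix.of_apply, Matrix.mul_apply]
  rw [integral_finsetSum _ fun k _ => (hf k b).const_mul _]
  simp only [integral_const_mul]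

theorem matrixIntegral_mul_const [Fintype ι] (hf : MatrixIntegrable μ f) (A : Matrix ι μ' ℂ) :
    matrixIntegral μ (fun x => f x * A) = matrixIntegral μ f * A := by
  ext a b
  simp only [matrixIntegral, Matrix.of_apply, Matrix.mul_apply]
  rw [integral_finsetSum _ fun k _ => (hf a k).mul_const _]
  simp only [integral_mul_const]

theorem MatrixIntegrable.const_mul [Fintype κ] (hf : MatrixIntegrable μ f) (A : Matrix μ' κ ℂ) :
    MatrixIntegrable μ fun x => A * f x := by
  intro a b
  simp only [Matrix.mul_apply]
  exact integrable_finsetSum _ fun k _ => (hf k b).const_mul _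

theorem MatrixIntegrable.trace [Fintype ι] {f : α → Matrix ι ι ℂ} (hf : MatrixIntegrable μ f) :
    Integrable (fun x => (f x).trace) μ :=
  integrable_finsetSum _ fun k _ => hf k k

theorem integral_trace [Fintype ι] {f : α → Matrix ι ι ℂ} (hf : MatrixIntegrable μ f) :
    ∫ x, (f x).trace ∂μ = (matrixIntegral μ f).trace := by
  simp only [Matrix.trace, Matrix.diag_apply]
  rw [integral_finsetSum _ fun k _ => hf k k]
  rfl

end MatrixIntegral

/-- The normalized Haar measure of `SU(2)`. -/
def haarSU2 : Measure SU2 :=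
  Measure.haarMeasure (⊤ : TopologicalSpace.PositiveCompacts SU2)

instance : IsProbabilityMeasure haarSU2 :=
  ⟨by rw [haarSU2, ← TopologicalSpace.PositiveCompacts.coe_top]; exact Measure.haarMeasure_self⟩

instance : haarSU2.IsMulLeftInvariant := by
  unfold haarSU2; infer_instance

/-! ### Twirling with the Haar measure -/

section Twirl

variable {ι κ : Type*} [Fintype ι] [DecidableEq ι] [Fintype κ] [DecidableEq κ]

/-- The average of `U_g X V_g†` over the group. -/
def twirl (π : UnitaryRep ι) (σ : UnitaryRep κ) (X : Matrix κ ι ℂ) : Matrix κ ι ℂ :=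
  matrixIntegral haarSU2 fun g => σ.toFun g * X * (π.toFun g)ᴴ

theorem UnitaryRep.continuous_conj (π : UnitaryRep ι) (σ : UnitaryRep κ) (X : Matrix κ ι ℂ) :
    Continuous fun g => σ.toFun g * X * (π.toFun g)ᴴ :=
  (σ.continuous.matrix_mul continuous_const).matrix_mul π.continuous.matrix_conjTranspose

theorem UnitaryRep.matrixIntegrable_conj (π : UnitaryRep ι) (σ : UnitaryRep κ)
    (X : Matrix κ ι ℂ) :
    MatrixIntegrable haarSU2 fun g => σ.toFun g * X * (π.toFun g)ᴴ := fun a b =>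
  ((π.continuous_conj σ X).matrix_elem a b).integrable_of_hasCompactSupport
    (HasCompactSupport.of_compactSpace _)

theorem UnitaryRep.mul_inv_self (π : UnitaryRep ι) (g : SU2) :
    π.toFun g * (π.toFun g)ᴴ = 1 := by
  rw [π.conjTranspose, ← π.map_mul, mul_inv_cancel, π.map_one]

theorem UnitaryRep.inv_mul_self (π : UnitaryRep ι) (g : SU2) :
    (π.toFun g)ᴴ * π.toFun g = 1 := by
  rw [π.conjTranspose, ← π.map_mul, inv_mul_cancel, π.map_one]

/-- Left invariance of Haar measure under g ↦ hg gives T = σ(h) T π(h)†. -/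
theorem twirl_intertwines (π : UnitaryRep ι) (σ : UnitaryRep κ) (X : Matrix κ ι ℂ) :
    Intertwines π σ (twirl π σ X) := by
  intro h
  have h1 : twirl π σ X =
      matrixIntegral haarSU2 fun g => σ.toFun (h * g) * X * (π.toFun (h * g))ᴴ := by
    ext a b
    exact (integral_mul_left_eq_self (fun g => (σ.toFun g * X * (π.toFun g)ᴴ) a b) h).symm
  have h2 : (fun g => σ.toFun (h * g) * X * (π.toFun (h * g))ᴴ) =
      fun g => σ.toFun h * (σ.toFun g * X * (π.toFun g)ᴴ * (π.toFun h)ᴴ) := by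
    ext1 g
    rw [σ.map_mul, π.map_mul, Matrix.conjTranspose_mul]
    simp only [Matrix.mul_assoc]
  have hint := π.matrixIntegrable_conj σ X
  have hint2 : MatrixIntegrable haarSU2
      fun g => σ.toFun g * X * (π.toFun g)ᴴ * (π.toFun h)ᴴ := by
    intro a b
    simp only [Matrix.mul_apply (N := (π.toFun h)ᴴ)]
    exact integrable_finsetSum _ fun k _ => (hint a k).mul_const _
  rw [h2, matrixIntegral_const_mul hint2, matrixIntegral_mul_const hint] at h1
  conv_lhs => rw [h1]
  rw [Matrix.mul_assoc, Matrix.mul_assoc, π.inv_mul_self, Matrix.mul_one]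
  rfl

/-- Intertwiners pass through the average, so the compression of a twirl to a summand is the twirl
of the compression. -/
theorem mul_twirl_mul {ι' κ' : Type*} [Fintype ι'] [DecidableEq ι'] [Fintype κ']
    [DecidableEq κ'] {π : UnitaryRep ι} {σ : UnitaryRep κ} {π' : UnitaryRep ι'}
    {σ' : UnitaryRep κ'} {S : Matrix κ' κ ℂ} {T : Matrix ι' ι ℂ} (hS : Intertwines σ σ' S)
    (hT : Intertwines π π' T) (X : Matrix κ ι ℂ) :
    S * twirl π σ X * Tᴴ = twirl π' σ' (S * X * Tᴴ) := by
  have hint := π.matrixIntegrable_conj σ X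
  rw [twirl, ← matrixIntegral_const_mul hint, ← matrixIntegral_mul_const (hint.const_mul S), twirl]
  congr 1
  ext1 g
  have h1 : (π.toFun g)ᴴ * Tᴴ = Tᴴ * (π'.toFun g)ᴴ := by
    rw [← Matrix.conjTranspose_mul, hT g, Matrix.conjTranspose_mul]
  simp only [Matrix.mul_assoc, h1]
  simp only [← Matrix.mul_assoc, hS g]

theorem trace_twirl (π : UnitaryRep ι) (X : Matrix ι ι ℂ) : (twirl π π X).trace = X.trace := by
  rw [twirl, ← integral_trace (π.matrixIntegrable_conj π X)]
  have : ∀ g, (π.toFun g * X * (π.toFun g)ᴴ).trace = X.trace := fun g => by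
    rw [Matrix.mul_assoc, Matrix.trace_mul_comm, Matrix.mul_assoc, π.inv_mul_self, Matrix.mul_one]
  simp [this]

end Twirl

/-- Schur's lemma makes the average a scalar, and the trace, preserved by conjugation, fixes it. -/
theorem twirl_spin (n : ℕ) (X : Matrix (Fin (n + 1)) (Fin (n + 1)) ℂ) :
    twirl (spin n) (spin n) X = (X.trace / (n + 1 : ℕ)) • 1 := by
  have h := intertwines_eq_smul_one (twirl_intertwines (spin n) (spin n) X)
  have h2 := trace_twirl (spin n) X
  rw [h, Matrix.trace_smul, Matrix.trace_one, Fintype.card_fin, smul_eq_mul] at h2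
  have h3 : ((n + 1 : ℕ) : ℂ) ≠ 0 := by exact_mod_cast n.succ_ne_zero
  rw [h, ← h2, mul_div_cancel_right₀ _ h3]

/-- The average over the group on `H_{1/2} ⊗ H_j`, by Schur's lemma. -/
theorem twirl_coupled (m : ℕ)
    (X : Matrix (Fin (1 + 1) × Fin (m + 1 + 1)) (Fin (1 + 1) × Fin (m + 1 + 1)) ℂ) :
    twirl (coupled (m + 1)) (coupled (m + 1)) X =
      ((spinProj (m + 1 + 1) (m + 1) * X).trace / (m + 1 + 1 + 1 : ℕ)) •
          spinProj (m + 1 + 1) (m + 1) +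
        ((spinProj m (m + 1) * X).trace / (m + 1 : ℕ)) • spinProj m (m + 1) := by
  set V := cgPlus (m + 1) with hV
  set W := cgMinus m with hW
  set T := twirl (coupled (m + 1)) (coupled (m + 1)) X with hT
  have hVi := cgPlus_intertwines (m + 1)
  have hWi := cgMinus_intertwines m
  have hTi := twirl_intertwines (coupled (m + 1)) (coupled (m + 1)) X
  have tr : ∀ {a : ℕ} (Y : Matrix (Fin (1 + 1) × Fin (m + 1 + 1)) (Fin (a + 1)) ℂ),
      (Yᴴ * X * Y).trace = (Y * Yᴴ * X).trace := fun Y => by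
    rw [Matrix.mul_assoc, Matrix.trace_mul_comm, Matrix.mul_assoc X, Matrix.trace_mul_comm X]
  have hVV : Vᴴ * T * V = ((V * Vᴴ * X).trace / (m + 1 + 1 + 1 : ℕ)) • 1 := by
    have := mul_twirl_mul hVi.conjTranspose hVi.conjTranspose X
    rw [Matrix.conjTranspose_conjTranspose, twirl_spin, tr] at this
    exact this
  have hWW : Wᴴ * T * W = ((W * Wᴴ * X).trace / (m + 1 : ℕ)) • 1 := by
    have := mul_twirl_mul hWi.conjTranspose hWi.conjTranspose X
    rw [Matrix.conjTranspose_conjTranspose, twirl_spin, tr] at this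
    exact this
  -- The off-diagonal blocks intertwine spins j+½ and j-½, which are disjoint; only the two diagonal
  -- scalars remain.
  have hVW : Vᴴ * T * W = 0 :=
    intertwines_eq_zero (by omega) ((hVi.conjTranspose.mul hTi).mul hWi)
  have hWV : Wᴴ * T * V = 0 :=
    intertwines_eq_zero (by omega) ((hWi.conjTranspose.mul hTi).mul hVi)
  calc T = (V * Vᴴ + W * Wᴴ) * T * (V * Vᴴ + W * Wᴴ) := by
        rw [hV, hW, cg_complete, Matrix.one_mul, Matrix.mul_one]
    _ = V * (Vᴴ * T * V) * Vᴴ + V * (Vᴴ * T * W) * Wᴴ + W * (Wᴴ * T * V) * Vᴴ +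
        W * (Wᴴ * T * W) * Wᴴ := by
      simp only [Matrix.add_mul, Matrix.mul_add, Matrix.mul_assoc]
      abel
    _ = _ := by
      rw [hVV, hWW, hVW, hWV, spinProj_plus, spinProj_minus]
      simp [hV, hW]

/-! ### The parameter space -/

instance : IsProbabilityMeasure nu :=
  haveI : IsProbabilityMeasure (Measure.haarMeasure
    (⊤ : TopologicalSpace.PositiveCompacts SU2)) := inferInstanceAs (IsProbabilityMeasure haarSU2)
  Measure.isProbabilityMeasure_map
    (QuotientGroup.measurable_coe (G := SU2) (S := U1)).aemeasurable

/-- The section `rep` is arbitrary and not known to be measurable. The quotient σ-algebra moves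
every measurability question on Θ to the group. -/
theorem measurable_theta_iff {β : Type*} [MeasurableSpace β] {f : Theta → β} :
    Measurable f ↔ Measurable fun g : SU2 => f g :=
  measurable_from_quotient

theorem integral_nu {f : Theta → ℂ} (hf : Measurable f) :
    ∫ θ, f θ ∂nu = ∫ g, f (QuotientGroup.mk g) ∂haarSU2 := by
  rw [nu, integral_map QuotientGroup.measurable_coe.aemeasurable hf.aestronglyMeasurable]
  rfl

theorem measurable_smul_theta (g : SU2) : Measurable fun θ : Theta => g • θ := by
  rw [measurable_theta_iff]
  exact QuotientGroup.measurable_coe.comp (measurable_const_mul g)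

theorem measurePreserving_smul_nu (g : SU2) :
    MeasurePreserving (fun θ : Theta => g • θ) nu nu := by
  refine ⟨measurable_smul_theta g, ?_⟩
  rw [nu, Measure.map_map (measurable_smul_theta g) QuotientGroup.measurable_coe]
  have h : (fun θ : Theta => g • θ) ∘ (QuotientGroup.mk : SU2 → Theta) =
      QuotientGroup.mk ∘ fun h => g * h := rfl
  rw [h, ← Measure.map_map QuotientGroup.measurable_coe (measurable_const_mul g)]
  congr 1
  exact map_mul_left_eq_self haarSU2 g

/-! ### Orbits of torus-invariant operators -/

section Orbit

variable {ι κ : Type*} [Fintype ι] [DecidableEq ι] [Fintype κ] [DecidableEq κ]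

/-- The operator `U_{g(θ)} X U_{g(θ)}†`. -/
def orbit (π : UnitaryRep ι) (X : Matrix ι ι ℂ) (θ : Theta) : Matrix ι ι ℂ :=
  π.toFun (rep θ) * X * (π.toFun (rep θ))ᴴ

/-- `X` commutes with the one-parameter group generated by `J₃`. -/
def TorusInvariant (π : UnitaryRep ι) (X : Matrix ι ι ℂ) : Prop :=
  ∀ t, π.toFun (torus t) * X * (π.toFun (torus t))ᴴ = X

variable {π : UnitaryRep ι} {σ : UnitaryRep κ} {X : Matrix ι ι ℂ} {Y : Matrix κ κ ℂ}

/-- Two representatives of a coset differ on the right by a torus element, which `X` absorbs. So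
`rep` disappears from all later computations. -/
theorem orbit_mk (hX : TorusInvariant π X) (g : SU2) :
    orbit π X (QuotientGroup.mk g) = π.toFun g * X * (π.toFun g)ᴴ := by
  obtain ⟨u, hu⟩ := QuotientGroup.mk_out_eq_mul U1 g
  obtain ⟨t, ht⟩ := exists_torus_of_mem_U1 u.2
  have h : rep (QuotientGroup.mk g) = g * torus t := by rw [← ht]; exact hu
  rw [orbit, h, π.map_mul, Matrix.conjTranspose_mul]
  conv_rhs => rw [← hX t]
  simp only [Matrix.mul_assoc]

theorem orbit_smul (hX : TorusInvariant π X) (g : SU2) (θ : Theta) :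
    orbit π X (g • θ) = π.toFun g * orbit π X θ * (π.toFun g)ᴴ := by
  induction θ using QuotientGroup.induction_on with
  | H h =>
    have : g • (QuotientGroup.mk h : Theta) = QuotientGroup.mk (g * h) := rfl
    rw [this, orbit_mk hX, orbit_mk hX, π.map_mul, Matrix.conjTranspose_mul]
    simp only [Matrix.mul_assoc]

theorem measurable_orbit (hX : TorusInvariant π X) (a b : ι) :
    Measurable fun θ => orbit π X θ a b := by
  rw [measurable_theta_iff]
  simp only [orbit_mk hX]
  exact ((π.continuous_conj π X).matrix_elem a b).measurable

theorem exists_bound_orbit (π : UnitaryRep ι) (X : Matrix ι ι ℂ) (a b : ι) :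
    ∃ C, ∀ θ, ‖orbit π X θ a b‖ ≤ C := by
  obtain ⟨C, hC⟩ := isCompact_univ.exists_bound_of_continuousOn
    ((π.continuous_conj π X).matrix_elem a b).continuousOn
  exact ⟨C, fun θ => hC (rep θ) (Set.mem_univ _)⟩

theorem matrixIntegrable_orbit (hX : TorusInvariant π X) (μ : Measure Theta)
    [IsFiniteMeasure μ] : MatrixIntegrable μ (orbit π X) := fun a b => by
  obtain ⟨C, hC⟩ := exists_bound_orbit π X a b
  exact Integrable.of_bound (measurable_orbit hX a b).aestronglyMeasurable C (ae_of_all _ hC)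

theorem matrixIntegral_orbit (hX : TorusInvariant π X) :
    matrixIntegral nu (orbit π X) = twirl π π X := by
  ext a b
  simp only [matrixIntegral, twirl, Matrix.of_apply]
  rw [integral_nu (measurable_orbit hX a b)]
  simp only [orbit_mk hX]

theorem orbit_tensor (θ : Theta) :
    orbit (π.tensor σ) (X ⊗ₖ Y) θ = orbit π X θ ⊗ₖ orbit σ Y θ := by
  simp only [orbit, UnitaryRep.tensor]
  rw [Matrix.conjTranspose_kronecker, ← Matrix.mul_kronecker_mul, ← Matrix.mul_kronecker_mul]

theorem TorusInvariant.tensor (hX : TorusInvariant π X) (hY : TorusInvariant σ Y) :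
    TorusInvariant (π.tensor σ) (X ⊗ₖ Y) := fun t => by
  simp only [UnitaryRep.tensor]
  rw [Matrix.conjTranspose_kronecker, ← Matrix.mul_kronecker_mul, ← Matrix.mul_kronecker_mul,
    hX t, hY t]

theorem posSemidef_orbit (hX : X.PosSemidef) (θ : Theta) : (orbit π X θ).PosSemidef :=
  hX.mul_mul_conjTranspose_same _

end Orbit

theorem torusInvariant_diagonal (n : ℕ) (d : Fin (n + 1) → ℂ) :
    TorusInvariant (spin n) (Matrix.diagonal d) := fun t => by
  have h := (spin n).mul_inv_self (torus t)
  have h2 : (spin n).toFun (torus t) * Matrix.diagonal d =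
      Matrix.diagonal d * (spin n).toFun (torus t) := by
    simp only [spin, spinRep_torus, Matrix.diagonal_mul_diagonal, mul_comm]
  rw [h2, Matrix.mul_assoc, h, Matrix.mul_one]

theorem ketBra_eq_diagonal (n : ℕ) (i : Fin (n + 1)) :
    ketBra n i = Matrix.diagonal (Pi.single i 1) := by
  rw [ketBra, Matrix.diagonal_single]

theorem torusInvariant_ketBra (n : ℕ) (i : Fin (n + 1)) :
    TorusInvariant (spin n) (ketBra n i) := by
  rw [ketBra_eq_diagonal]
  exact torusInvariant_diagonal n _

theorem ketBra_posSemidef (n : ℕ) (i : Fin (n + 1)) : (ketBra n i).PosSemidef := by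
  rw [ketBra_eq_diagonal]
  refine Matrix.PosSemidef.diagonal fun k => ?_
  by_cases h : k = i
  · subst h; simp
  · simp [h]

theorem trace_ketBra (n : ℕ) (i : Fin (n + 1)) : (ketBra n i).trace = 1 := by
  rw [ketBra, Matrix.trace_single_eq_same]

/-! ### Densities of operator valued measures -/

section PosSemidef

variable {ι : Type*} [Fintype ι]

open scoped MatrixOrder in
theorem trace_mul_nonneg [DecidableEq ι] {σ A : Matrix ι ι ℂ} (hσ : σ.PosSemidef) (hA : A.PosSemidef) :
    0 ≤ (σ * A).trace := by
  obtain ⟨B, rfl⟩ := CStarAlgebra.nonneg_iff_eq_star_mul_self.mp hA.nonneg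
  rw [Matrix.star_eq_conjTranspose]
  have h := (hσ.mul_mul_conjTranspose_same B).trace_nonneg
  rwa [Matrix.trace_mul_comm, ← Matrix.mul_assoc, Matrix.trace_mul_comm] at h

theorem trace_vecMulVec_star_mul (x : ι → ℂ) (A : Matrix ι ι ℂ) :
    (Matrix.vecMulVec x (star x) * A).trace = star x ⬝ᵥ A *ᵥ x := by
  rw [Matrix.vecMulVec_mul, Matrix.trace_vecMulVec, dotProduct_comm, ← Matrix.dotProduct_mulVec]

theorem posSemidef_vecMulVec_star (x : ι → ℂ) : (Matrix.vecMulVec x (star x)).PosSemidef :=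
  Matrix.posSemidef_vecMulVec_self_star x

/-- Testing against rank-one operators turns operator positivity into positivity of real numbers,
which integrals and almost-everywhere arguments can handle. -/
theorem posSemidef_of_trace_vecMulVec_nonneg {A : Matrix ι ι ℂ} (hA : A.IsHermitian)
    (h : ∀ x : ι → ℂ, 0 ≤ (Matrix.vecMulVec x (star x) * A).trace.re) : A.PosSemidef := by
  refine Matrix.PosSemidef.of_dotProduct_mulVec_nonneg hA fun x => ?_
  rw [Complex.nonneg_iff, ← trace_vecMulVec_star_mul]
  refine ⟨h x, ?_⟩
  rw [trace_vecMulVec_star_mul]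
  exact (hA.im_star_dotProduct_mulVec_self x).symm

variable {α : Type*} [MeasurableSpace α] {μ : Measure α}

theorem integral_trace_mul_re {f : α → Matrix ι ι ℂ} (hf : MatrixIntegrable μ f)
    (A : Matrix ι ι ℂ) :
    ∫ x, (A * f x).trace.re ∂μ = (A * matrixIntegral μ f).trace.re := by
  rw [← matrixIntegral_const_mul hf, ← integral_trace (hf.const_mul A)]
  exact integral_re (hf.const_mul A).trace

theorem MatrixIntegrable.trace_mul_re {f : α → Matrix ι ι ℂ} (hf : MatrixIntegrable μ f)
    (A : Matrix ι ι ℂ) : Integrable (fun x => (A * f x).trace.re) μ :=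
  (hf.const_mul A).trace.re

theorem posSemidef_matrixIntegral [DecidableEq ι] {f : α → Matrix ι ι ℂ} (hf : MatrixIntegrable μ f)
    (h : ∀ᵐ x ∂μ, (f x).PosSemidef) : (matrixIntegral μ f).PosSemidef := by
  refine posSemidef_of_trace_vecMulVec_nonneg ?_ fun x => ?_
  · ext a b
    rw [Matrix.conjTranspose_apply]
    simp only [matrixIntegral, Matrix.of_apply, RCLike.star_def]
    rw [← integral_conj]
    refine integral_congr_ae (h.mono fun x hx => ?_)
    exact hx.isHermitian.apply a b
  · rw [← integral_trace_mul_re hf]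
    exact integral_nonneg_of_ae (h.mono fun y hy =>
      (Complex.nonneg_iff.mp (trace_mul_nonneg (posSemidef_vecMulVec_star x) hy)).1)

end PosSemidef

/-! ### Radon–Nikodym densities of POVMs -/

section Density

variable {X : Type*} [MeasurableSpace X] {ι : Type*} [Fintype ι] [DecidableEq ι]

/-- `D` is a density of the operator valued measure `M` with respect to `μ`. -/
structure IsDensity (M : POVM X ι) (μ : Measure X) (D : X → Matrix ι ι ℂ) : Prop where
  integrable : MatrixIntegrable μ D
  posSemidef : ∀ᵐ x ∂μ, (D x).PosSemidef
  setIntegral : ∀ B, MeasurableSet B → matrixIntegral (μ.restrict B) D = M.meas B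

theorem law_apply (M : POVM X ι) {σ : Matrix ι ι ℂ} (hσ : σ.PosSemidef) {B : Set X}
    (hB : MeasurableSet B) : M.law σ hσ B = ENNReal.ofReal (σ * M.meas B).trace.re := by
  rw [POVM.law, SignedMeasure.toMeasureOfZeroLE_apply _ _ _ hB]
  have h : (0 : ℝ) ≤ (σ * M.meas B).trace.re := traceAgainst_nonneg hσ (M.posSemidef B hB)
  rw [ENNReal.ofReal, Real.toNNReal_of_nonneg h]
  congr 2
  simp only [Set.univ_inter]
  rfl

instance (M : POVM X ι) {σ : Matrix ι ι ℂ} (hσ : σ.PosSemidef) :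
    IsFiniteMeasure (M.law σ hσ) :=
  ⟨by rw [law_apply M hσ MeasurableSet.univ]; exact ENNReal.ofReal_lt_top⟩

/-- The complex measure given by a matrix entry of an operator valued measure. -/
def entryMeasure (M : POVM X ι) (a b : ι) : ComplexMeasure X :=
  M.meas.mapRange (Matrix.entryAddMonoidHom ℂ a b) (continuous_id.matrix_elem a b)

/-- The law in the unnormalized state 1 is the trace measure Tr M(B). A positive semidefinite matrix
of trace zero vanishes, so this measure dominates every matrix entry of `M`. -/
theorem eq_zero_of_law_eq_zero (M : POVM X ι) {B : Set X} (hB : MeasurableSet B)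
    (h : M.law 1 Matrix.PosSemidef.one B = 0) : M.meas B = 0 := by
  have hps := M.posSemidef B hB
  rw [law_apply M _ hB, Matrix.one_mul, ENNReal.ofReal_eq_zero] at h
  refine hps.trace_eq_zero_iff.mp ?_
  have h2 := Complex.nonneg_iff.mp hps.trace_nonneg
  exact Complex.ext (le_antisymm h h2.1) h2.2.symm

theorem setIntegral_rnDeriv_entryMeasure (M : POVM X ι) (a b : ι) {B : Set X}
    (hB : MeasurableSet B) :
    ∫ x in B, (entryMeasure M a b).rnDeriv (M.law 1 Matrix.PosSemidef.one) x
      ∂(M.law 1 Matrix.PosSemidef.one) = M.meas B a b := by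
  set μ := M.law 1 Matrix.PosSemidef.one with hμ
  set c := entryMeasure M a b with hc
  have hac : ∀ s, MeasurableSet s → μ s = 0 → c s = 0 := fun s hs h => by
    have := eq_zero_of_law_eq_zero M hs h
    change M.meas s a b = 0
    rw [this, Matrix.zero_apply]
  have hre : (ComplexMeasure.re c) ≪ᵥ μ.toENNRealVectorMeasure :=
    VectorMeasure.AbsolutelyContinuous.mk fun s hs h => by
      rw [Measure.toENNRealVectorMeasure_apply_measurable hs] at h
      change (c s).re = 0
      rw [hac s hs h, Complex.zero_re]
  have him : (ComplexMeasure.im c) ≪ᵥ μ.toENNRealVectorMeasure :=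
    VectorMeasure.AbsolutelyContinuous.mk fun s hs h => by
      rw [Measure.toENNRealVectorMeasure_apply_measurable hs] at h
      change (c s).im = 0
      rw [hac s hs h, Complex.zero_im]
  have h1 := SignedMeasure.withDensityᵥ_rnDeriv_eq _ μ hre
  have h2 := SignedMeasure.withDensityᵥ_rnDeriv_eq _ μ him
  have hint : IntegrableOn (c.rnDeriv μ) B μ := (ComplexMeasure.integrable_rnDeriv c μ).integrableOn
  have h3 := congrArg (fun s => s B) h1
  have h4 := congrArg (fun s => s B) h2
  simp only [withDensityᵥ_apply (SignedMeasure.integrable_rnDeriv _ _) hB] at h3 h4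
  refine Complex.ext ?_ ?_
  · refine (integral_re hint).symm.trans ?_
    exact h3
  · refine (integral_im hint).symm.trans ?_
    exact h4

/-- The reference measure is the trace measure, and Radon–Nikodym applies to each entry. Positivity
of M(B) for all B passes to the density almost everywhere. -/
theorem exists_isDensity (M : POVM X ι) :
    ∃ (μ : Measure X) (_ : IsFiniteMeasure μ) (D : X → Matrix ι ι ℂ), IsDensity M μ D := by
  set μ := M.law 1 Matrix.PosSemidef.one with hμ
  set D₀ : X → Matrix ι ι ℂ := fun x => Matrix.of fun a b => (entryMeasure M a b).rnDeriv μ x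
    with hD₀
  have hD₀i : MatrixIntegrable μ D₀ := fun a b => ComplexMeasure.integrable_rnDeriv _ μ
  -- The entrywise derivatives need not form a Hermitian matrix at every point. The Hermitian part
  -- does, and it has the same integrals because each M(B) is Hermitian.
  set D : X → Matrix ι ι ℂ := fun x => (2⁻¹ : ℂ) • (D₀ x + (D₀ x)ᴴ) with hD
  have hD₀c : ∀ a b, Integrable (fun x => (starRingEnd ℂ) (D₀ x a b)) μ := fun a b =>
    Complex.conjLIE.toContinuousLinearEquiv.toContinuousLinearMap.integrable_comp (hD₀i a b)
  have hDi : MatrixIntegrable μ D := fun a b =>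
    ((hD₀i a b).add (hD₀c b a)).const_mul _
  have hDs : ∀ B, MeasurableSet B → matrixIntegral (μ.restrict B) D = M.meas B := by
    intro B hB
    ext a b
    have h1 := setIntegral_rnDeriv_entryMeasure M a b hB
    have h2 := setIntegral_rnDeriv_entryMeasure M b a hB
    have h3 : ∫ x in B, (starRingEnd ℂ) (D₀ x b a) ∂μ = (starRingEnd ℂ) (M.meas B b a) := by
      rw [integral_conj]
      exact congrArg _ h2
    have h4 : (starRingEnd ℂ) (M.meas B b a) = M.meas B a b :=
      (M.posSemidef B hB).isHermitian.apply a b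
    have h5 : matrixIntegral (μ.restrict B) D a b =
        2⁻¹ * ∫ x in B, (D₀ x a b + (starRingEnd ℂ) (D₀ x b a)) ∂μ := by
      rw [← integral_const_mul]
      rfl
    rw [h5, integral_add (hD₀i a b).integrableOn (hD₀c b a).integrableOn, h3, h4]
    change 2⁻¹ * ((∫ x in B, (entryMeasure M a b).rnDeriv μ x ∂μ) + _) = _
    rw [h1]
    ring
  have hDh : ∀ x, (D x).IsHermitian := fun x => by
    rw [Matrix.IsHermitian, hD]
    simp [add_comm]
  refine ⟨μ, inferInstance, D, hDi, ?_, hDs⟩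
  -- The exceptional null set depends on the test vector, so only a countable dense family is used;
  -- continuity in the vector extends positivity to all of them.
  have hae : ∀ᵐ x ∂μ, ∀ k, 0 ≤ (Matrix.vecMulVec (TopologicalSpace.denseSeq (ι → ℂ) k)
      (star (TopologicalSpace.denseSeq (ι → ℂ) k)) * D x).trace.re := by
    refine ae_all_iff.mpr fun k => ?_
    refine ae_nonneg_of_forall_setIntegral_nonneg (hDi.trace_mul_re _) fun B hB _ => ?_
    have hB' : MatrixIntegrable (μ.restrict B) D := fun a b => (hDi a b).integrableOn
    rw [integral_trace_mul_re hB', hDs B hB]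
    exact traceAgainst_nonneg (posSemidef_vecMulVec_star _) (M.posSemidef B hB)
  refine hae.mono fun x hx => posSemidef_of_trace_vecMulVec_nonneg (hDh x) fun v => ?_
  have hcl : IsClosed {v : ι → ℂ | 0 ≤ (Matrix.vecMulVec v (star v) * D x).trace.re} := by
    refine isClosed_le continuous_const (Complex.continuous_re.comp ?_)
    refine Continuous.matrix_trace (Continuous.matrix_mul ?_ continuous_const)
    exact continuous_id.matrix_vecMulVec continuous_star
  have hsub : Set.range (TopologicalSpace.denseSeq (ι → ℂ)) ⊆
      {v : ι → ℂ | 0 ≤ (Matrix.vecMulVec v (star v) * D x).trace.re} := by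
    rintro _ ⟨k, rfl⟩
    exact hx k
  have := hcl.closure_subset_iff.mpr hsub
  rw [(TopologicalSpace.denseRange_denseSeq (ι → ℂ)).closure_range] at this
  exact this (Set.mem_univ v)

variable {M : POVM X ι} {μ : Measure X} {D : X → Matrix ι ι ℂ}

theorem IsDensity.trace_nonneg (h : IsDensity M μ D) {σ : Matrix ι ι ℂ} (hσ : σ.PosSemidef) :
    0 ≤ᵐ[μ] fun x => (σ * D x).trace.re :=
  h.posSemidef.mono fun _ hx => (Complex.nonneg_iff.mp (trace_mul_nonneg hσ hx)).1

theorem IsDensity.law_eq (h : IsDensity M μ D) {σ : Matrix ι ι ℂ} (hσ : σ.PosSemidef) :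
    M.law σ hσ = μ.withDensity fun x => ENNReal.ofReal (σ * D x).trace.re := by
  ext B hB
  have hB' : MatrixIntegrable (μ.restrict B) D := fun a b => (h.integrable a b).integrableOn
  rw [law_apply M hσ hB, withDensity_apply _ hB,
    ← ofReal_integral_eq_lintegral_ofReal (hB'.trace_mul_re σ)
      (ae_restrict_of_ae (h.trace_nonneg hσ)),
    integral_trace_mul_re hB', h.setIntegral B hB]

theorem IsDensity.integral_law (h : IsDensity M μ D) {σ : Matrix ι ι ℂ} (hσ : σ.PosSemidef)
    (f : X → ℝ) : ∫ x, f x ∂(M.law σ hσ) = ∫ x, f x * (σ * D x).trace.re ∂μ := by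
  rw [h.law_eq hσ, integral_withDensity_eq_integral_toReal_smul₀
    (h.integrable.trace_mul_re σ).aemeasurable.ennreal_ofReal (ae_of_all _ fun _ =>
      ENNReal.ofReal_lt_top)]
  refine integral_congr_ae ((h.trace_nonneg hσ).mono fun x hx => ?_)
  simp only [smul_eq_mul, ENNReal.toReal_ofReal hx, mul_comm]

end Density

/-! ### Covariant operator valued measures -/

section CovariantPOVM

variable {n : ℕ} {T : Matrix (Fin (n + 1)) (Fin (n + 1)) ℂ}

/-- The density of the operator valued measure generated by `T`. -/
def covariantDensity (n : ℕ) (T : Matrix (Fin (n + 1)) (Fin (n + 1)) ℂ) (θ : Theta) :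
    Matrix (Fin (n + 1)) (Fin (n + 1)) ℂ :=
  ((n + 1 : ℕ) : ℂ) • orbit (spin n) T θ

theorem matrixIntegrable_covariantDensity (hT : TorusInvariant (spin n) T) (μ : Measure Theta)
    [IsFiniteMeasure μ] : MatrixIntegrable μ (covariantDensity n T) := fun a b =>
  (matrixIntegrable_orbit hT μ a b).const_mul _

theorem posSemidef_covariantDensity (hT : T.PosSemidef) (θ : Theta) :
    (covariantDensity n T θ).PosSemidef :=
  (posSemidef_orbit hT θ).smul (Nat.cast_nonneg _)

/-- The operator valued measure generated by `T`. -/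
def covariantPOVM (hT : TorusInvariant (spin n) T) (hT0 : T.PosSemidef) (hT1 : T.trace = 1) :
    POVM Theta (Fin (n + 1)) where
  meas :=
    { measureOf' := fun B => Matrix.of fun a b =>
        nu.withDensityᵥ (fun θ => covariantDensity n T θ a b) B
      empty' := by ext a b; simp
      not_measurable' := fun B hB => by
        ext a b
        simp [VectorMeasure.not_measurable _ hB]
      m_iUnion' := fun f hf hd => by
        refine Pi.hasSum.mpr fun a => Pi.hasSum.mpr fun b => ?_
        exact VectorMeasure.m_iUnion _ hf hd }
  posSemidef B hB := by
    have hi := matrixIntegrable_covariantDensity hT (nu.restrict B)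
    have h := posSemidef_matrixIntegral hi (ae_of_all _ (posSemidef_covariantDensity hT0))
    convert h using 1
    ext a b
    exact withDensityᵥ_apply (matrixIntegrable_covariantDensity hT nu a b) hB
  total := by
    ext a b
    refine (withDensityᵥ_apply (matrixIntegrable_covariantDensity hT nu a b)
      MeasurableSet.univ).trans ?_
    have h1 : ∫ θ in Set.univ, covariantDensity n T θ a b ∂nu =
        ((n + 1 : ℕ) : ℂ) * matrixIntegral nu (orbit (spin n) T) a b := by
      rw [setIntegral_univ]
      exact integral_const_mul _ _
    have h3 : ((n + 1 : ℕ) : ℂ) ≠ 0 := by exact_mod_cast n.succ_ne_zero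
    -- The prefactor n+1 = dim H_j cancels the dimension by which Schur's lemma divides the trace.
    rw [h1, matrixIntegral_orbit hT, twirl_spin, hT1, Matrix.smul_apply, smul_eq_mul, ← mul_assoc,
      mul_one_div_cancel h3, one_mul]

variable (hT : TorusInvariant (spin n) T) (hT0 : T.PosSemidef) (hT1 : T.trace = 1)

theorem isDensity_covariantPOVM :
    IsDensity (covariantPOVM hT hT0 hT1) nu (covariantDensity n T) where
  integrable := matrixIntegrable_covariantDensity hT nu
  posSemidef := ae_of_all _ (posSemidef_covariantDensity hT0)
  setIntegral B hB := by
    ext a b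
    exact (withDensityᵥ_apply (matrixIntegrable_covariantDensity hT nu a b) hB).symm

theorem isGeneratedBy_covariantPOVM : IsGeneratedBy (covariantPOVM hT hT0 hT1) T := by
  intro B hB a b
  rw [← (isDensity_covariantPOVM hT hT0 hT1).setIntegral B hB]
  refine (integral_const_mul _ _).trans ?_
  rw [Nat.cast_add, Nat.cast_one]
  rfl

/-- The density is equivariant and ν is invariant, so the change of variables θ ↦ gθ carries B to
gB. -/
theorem isCovariant_covariantPOVM : IsCovariant (covariantPOVM hT hT0 hT1) := by
  intro g B hB
  have hpre : (fun θ : Theta => g⁻¹ • θ) ⁻¹' B = g • B := by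
    ext θ
    exact Set.mem_smul_set_iff_inv_smul_mem.symm
  have hgB : MeasurableSet (g • B) := hpre ▸ measurable_smul_theta g⁻¹ hB
  have hd := isDensity_covariantPOVM hT hT0 hT1
  have hi := matrixIntegrable_covariantDensity hT (nu.restrict B)
  rw [← hd.setIntegral B hB, ← hd.setIntegral _ hgB, ← matrixIntegral_const_mul hi,
    ← matrixIntegral_mul_const (hi.const_mul _)]
  have h1 : ∀ θ, spinRep n g * covariantDensity n T θ * (spinRep n g)ᴴ =
      covariantDensity n T (g • θ) := fun θ => by
    rw [covariantDensity, covariantDensity, orbit_smul hT, Matrix.mul_smul, Matrix.smul_mul]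
    rfl
  simp only [h1]
  have hpre2 : (fun θ : Theta => g • θ) ⁻¹' (g • B) = B := by
    rw [Set.preimage_smul, inv_smul_smul]
  ext a b
  have hm : AEStronglyMeasurable (fun θ => covariantDensity n T θ a b)
      (nu.map fun θ : Theta => g • θ) := by
    rw [(measurePreserving_smul_nu g).map_eq]
    exact (hd.integrable a b).aestronglyMeasurable
  simp only [matrixIntegral, Matrix.of_apply]
  conv_rhs => rw [← (measurePreserving_smul_nu g).map_eq]
  rw [setIntegral_map hgB hm (measurable_smul_theta g).aemeasurable, hpre2]

end CovariantPOVM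

/-! ### The gain of an estimator -/

section Gain

variable {n : ℕ}

theorem torusInvariant_coupled {X : Matrix (Fin (n + 1)) (Fin (n + 1)) ℂ}
    (hX : TorusInvariant (spin n) X) : TorusInvariant (coupled n) (ketBra 1 0 ⊗ₖ X) :=
  (torusInvariant_ketBra 1 0).tensor hX

/-- The score operator `∫ (U_θ |½;½⟩⟨½;½| U_θ†) ⊗ D(θ) μ(dθ)` on `H_{1/2} ⊗ H_j`. -/
def scoreOperator (μ : Measure Theta) (D : Theta → Matrix (Fin (n + 1)) (Fin (n + 1)) ℂ) :
    Matrix (Fin (1 + 1) × Fin (n + 1)) (Fin (1 + 1) × Fin (n + 1)) ℂ :=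
  matrixIntegral μ fun θ => orbit (spin 1) (ketBra 1 0) θ ⊗ₖ D θ

theorem matrixIntegrable_score {μ : Measure Theta}
    {D : Theta → Matrix (Fin (n + 1)) (Fin (n + 1)) ℂ} (hD : MatrixIntegrable μ D) :
    MatrixIntegrable μ fun θ => orbit (spin 1) (ketBra 1 0) θ ⊗ₖ D θ := fun a b => by
  obtain ⟨C, hC⟩ := exists_bound_orbit (spin 1) (ketBra 1 0) a.1 b.1
  exact (hD a.2 b.2).bdd_mul
    (measurable_orbit (torusInvariant_ketBra 1 0) a.1 b.1).aestronglyMeasurable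
    (ae_of_all _ hC)

theorem gain_eq (θ θ' : Theta) : gain θ θ' =
    (orbit (spin 1) (ketBra 1 0) θ * orbit (spin 1) (ketBra 1 0) θ').trace.re := rfl

theorem gain_nonneg (θ θ' : Theta) : 0 ≤ gain θ θ' :=
  traceAgainst_nonneg (posSemidef_orbit (π := spin 1) (ketBra_posSemidef 1 0) θ)
    (posSemidef_orbit (π := spin 1) (ketBra_posSemidef 1 0) θ')

variable {p : Fin (n + 1) → ℝ} (hp : ∀ i, 0 ≤ p i)

/-- The gain and the outcome density are two traces, and their product is one trace over H_{1/2} ⊗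
H_j. The estimator then enters only through its score operator. -/
theorem averageGain_eq {M : POVM Theta (Fin (n + 1))} {μ : Measure Theta}
    {D : Theta → Matrix (Fin (n + 1)) (Fin (n + 1)) ℂ} (hD : IsDensity M μ D) (θ : Theta) :
    averageGain p hp M θ =
      (orbit (coupled n) (ketBra 1 0 ⊗ₖ diagState p) θ * scoreOperator μ D).trace.re := by
  rw [averageGain, hD.integral_law, scoreOperator,
    ← integral_trace_mul_re (matrixIntegrable_score hD.integrable)]
  refine integral_congr_ae (ae_of_all _ fun θ' => ?_)
  have h1 : orbit (coupled n) (ketBra 1 0 ⊗ₖ diagState p) θ =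
      orbit (spin 1) (ketBra 1 0) θ ⊗ₖ modelState p θ := orbit_tensor θ
  -- The trace defining the gain is real, so the real part of the product is the product of real
  -- parts.
  have h2 := Complex.nonneg_iff.mp (trace_mul_nonneg
    (posSemidef_orbit (π := spin 1) (ketBra_posSemidef 1 0) θ)
    (posSemidef_orbit (π := spin 1) (ketBra_posSemidef 1 0) θ'))
  simp only
  rw [h1, ← Matrix.mul_kronecker_mul, Matrix.trace_kronecker, Complex.mul_re, ← h2.2, zero_mul,
    sub_zero, gain_eq]

theorem averageGain_nonneg (M : POVM Theta (Fin (n + 1))) (θ : Theta) :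
    0 ≤ averageGain p hp M θ :=
  integral_nonneg fun θ' => gain_nonneg θ θ'

theorem torusInvariant_diagState (p : Fin (n + 1) → ℝ) :
    TorusInvariant (spin n) (diagState p) := torusInvariant_diagonal n _

/-- Regularity in θ is not visible from the definition, where the measure itself varies with θ. The
trace formula shows it: a bounded measurable orbit against a fixed matrix. -/
theorem integrable_averageGain (M : POVM Theta (Fin (n + 1))) :
    Integrable (averageGain p hp M) nu := by
  obtain ⟨μ, _, D, hD⟩ := exists_isDensity M
  rw [funext (averageGain_eq hp hD)]
  simp only [Matrix.trace_mul_comm _ (scoreOperator μ D)]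
  exact (matrixIntegrable_orbit (torusInvariant_coupled
    (torusInvariant_diagState p)) nu).trace_mul_re _

theorem bayesGain_eq {M : POVM Theta (Fin (n + 1))} {μ : Measure Theta}
    {D : Theta → Matrix (Fin (n + 1)) (Fin (n + 1)) ℂ} (hD : IsDensity M μ D) :
    bayesGain p hp M = (twirl (coupled n) (coupled n) (ketBra 1 0 ⊗ₖ diagState p) *
      scoreOperator μ D).trace.re := by
  have hX := torusInvariant_coupled (torusInvariant_diagState p)
  rw [bayesGain, funext (averageGain_eq hp hD)]
  simp only [Matrix.trace_mul_comm _ (scoreOperator μ D)]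
  rw [integral_trace_mul_re (matrixIntegrable_orbit hX nu), matrixIntegral_orbit hX]

theorem worstGain_le_bayesGain (M : POVM Theta (Fin (n + 1))) :
    worstGain p hp M ≤ bayesGain p hp M := by
  -- A real infimum over a set unbounded below would default to 0.
  have hb : BddBelow (Set.range (averageGain p hp M)) :=
    ⟨0, by rintro _ ⟨θ, rfl⟩; exact averageGain_nonneg hp M θ⟩
  calc worstGain p hp M = ∫ _θ, worstGain p hp M ∂nu := by simp
    _ ≤ bayesGain p hp M :=
      integral_mono (integrable_const _) (integrable_averageGain hp M) fun θ => ciInf_le hb θ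

theorem trace_orbit (π : UnitaryRep (Fin (n + 1))) (X : Matrix (Fin (n + 1)) (Fin (n + 1)) ℂ)
    (θ : Theta) : (orbit π X θ).trace = X.trace := by
  rw [orbit, Matrix.mul_assoc, Matrix.trace_mul_comm, Matrix.mul_assoc, π.inv_mul_self,
    Matrix.mul_one]

/-- The spin-½ factor has trace 1, so this is Tr M(Θ) = dim H_j. Together with positivity it is all
that the upper bound uses about `M`. -/
theorem trace_scoreOperator {M : POVM Theta (Fin (n + 1))} {μ : Measure Theta}
    {D : Theta → Matrix (Fin (n + 1)) (Fin (n + 1)) ℂ} (hD : IsDensity M μ D) :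
    (scoreOperator μ D).trace = (n + 1 : ℕ) := by
  rw [scoreOperator, ← integral_trace (matrixIntegrable_score hD.integrable)]
  have h : ∀ θ, (orbit (spin 1) (ketBra 1 0) θ ⊗ₖ D θ).trace = (D θ).trace := fun θ => by
    rw [Matrix.trace_kronecker, trace_orbit, trace_ketBra, one_mul]
  simp only [h]
  have hu := hD.setIntegral Set.univ MeasurableSet.univ
  rw [M.total, Measure.restrict_univ] at hu
  rw [integral_trace hD.integrable, hu, Matrix.trace_one, Fintype.card_fin]

theorem posSemidef_scoreOperator {M : POVM Theta (Fin (n + 1))} {μ : Measure Theta}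
    {D : Theta → Matrix (Fin (n + 1)) (Fin (n + 1)) ℂ} (hD : IsDensity M μ D) :
    (scoreOperator μ D).PosSemidef :=
  posSemidef_matrixIntegral (matrixIntegrable_score hD.integrable) (hD.posSemidef.mono
    fun θ hθ => (posSemidef_orbit (ketBra_posSemidef 1 0) θ).kronecker hθ)

end Gain

/-! ### The upper bound and its attainment -/

section Optimal

variable {m : ℕ} {p : Fin (m + 1 + 1) → ℝ} (hp : ∀ i, 0 ≤ p i)

theorem spinProj_add_spinProj (m : ℕ) :
    spinProj (m + 1 + 1) (m + 1) + spinProj m (m + 1) = 1 := by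
  rw [spinProj_plus, spinProj_minus, cg_complete]

theorem re_mul_of_im_eq_zero {z w : ℂ} (h : w.im = 0) : (z * w).re = z.re * w.re := by
  rw [Complex.mul_re, h, mul_zero, sub_zero]

/-- No estimator has a larger Bayesian gain than the optimal one. -/
theorem bayesGain_le (hcond : 1 / (((m + 1 : ℕ) : ℝ) + 2) *
      couplingWeight (m + 1 + 1) (m + 1) (diagState p) ≥
      1 / ((m + 1 : ℕ) : ℝ) * couplingWeight m (m + 1) (diagState p))
    (M : POVM Theta (Fin (m + 1 + 1))) :
    bayesGain p hp M ≤ (((m + 1 : ℕ) : ℝ) + 1) / (((m + 1 : ℕ) : ℝ) + 2) *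
      couplingWeight (m + 1 + 1) (m + 1) (diagState p) := by
  obtain ⟨μ, _, D, hD⟩ := exists_isDensity M
  set E := scoreOperator μ D
  have hE : E.PosSemidef := posSemidef_scoreOperator hD
  have hplus : (spinProj (m + 1 + 1) (m + 1)).PosSemidef := by
    rw [spinProj_plus]; exact Matrix.posSemidef_self_mul_conjTranspose _
  have hminus : (spinProj m (m + 1)).PosSemidef := by
    rw [spinProj_minus]; exact Matrix.posSemidef_self_mul_conjTranspose _
  have h1 := Complex.nonneg_iff.mp (trace_mul_nonneg hplus hE)
  have h2 := Complex.nonneg_iff.mp (trace_mul_nonneg hminus hE)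
  have h3 : (spinProj (m + 1 + 1) (m + 1) * E).trace.re + (spinProj m (m + 1) * E).trace.re =
      ((m + 1 : ℕ) : ℝ) + 1 := by
    rw [← Complex.add_re, ← Matrix.trace_add, ← Matrix.add_mul, spinProj_add_spinProj,
      Matrix.one_mul, trace_scoreOperator hD]
    simp
  rw [bayesGain_eq hp hD, twirl_coupled, Matrix.add_mul, Matrix.trace_add, Matrix.smul_mul,
    Matrix.smul_mul, Matrix.trace_smul, Matrix.trace_smul, Complex.add_re, smul_eq_mul,
    smul_eq_mul, re_mul_of_im_eq_zero h1.2.symm, re_mul_of_im_eq_zero h2.2.symm,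
    Complex.div_natCast_re, Complex.div_natCast_re]
  change couplingWeight (m + 1 + 1) (m + 1) (diagState p) / _ * _ +
    couplingWeight m (m + 1) (diagState p) / _ * _ ≤ _
  have h4 : ((m + 1 + 1 + 1 : ℕ) : ℝ) = ((m + 1 : ℕ) : ℝ) + 2 := by push_cast; ring
  rw [h4]
  -- The hypothesis replaces the coefficient of P_{j-½} by the larger one of P_{j+½}; the two
  -- weights of the score operator then add up to its trace.
  have h5 := mul_le_mul_of_nonneg_right hcond.le h2.1
  calc _ ≤ 1 / (((m + 1 : ℕ) : ℝ) + 2) * couplingWeight (m + 1 + 1) (m + 1) (diagState p) *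
        ((spinProj (m + 1 + 1) (m + 1) * E).trace.re + (spinProj m (m + 1) * E).trace.re) := by
        rw [mul_add]
        refine add_le_add (le_of_eq (by ring)) (le_trans (le_of_eq (by ring)) h5)
    _ = _ := by rw [h3]; ring

/-- The product of highest weight vectors has weight j+½, which does not occur in H_{j-½}. -/
theorem spinProj_minus_mul_highest (m : ℕ) :
    spinProj m (m + 1) * (ketBra 1 0 ⊗ₖ ketBra (m + 1) 0) = 0 := by
  have h : (cgMinus m)ᴴ * (ketBra 1 0 ⊗ₖ ketBra (m + 1) 0) = 0 := by
    rw [ketBra, ketBra, Matrix.single_kronecker_single]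
    ext i q
    have h0 : (cgMinus m)ᴴ i (0, 0) = 0 := by
      rw [Matrix.conjTranspose_apply]
      simp [cgMinus, (Fin.succ_ne_zero i).symm]
    by_cases hq : q = (0, 0)
    · subst hq; rw [Matrix.mul_single_apply_same, h0, zero_mul]; rfl
    · rw [Matrix.mul_single_apply_of_ne _ _ _ _ _ hq]; rfl
  rw [spinProj_minus, Matrix.mul_assoc, h, Matrix.mul_zero]

/-- The operator valued measure generated by `|j;j⟩⟨j;j|`. -/
def optimalPOVM (n : ℕ) : POVM Theta (Fin (n + 1)) :=
  covariantPOVM (torusInvariant_ketBra n 0) (ketBra_posSemidef n 0) (trace_ketBra n 0)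

/-- The score operator is 2j+1 times the twirl of a rank-one projector lying in H_{j+½}; its trace
against P_{j+½} is 1, and dim H_{j+½} = 2j+2 gives the factor. -/
theorem scoreOperator_optimal (m : ℕ) :
    scoreOperator nu (covariantDensity (m + 1) (ketBra (m + 1) 0)) =
      (((m + 1 + 1 : ℕ) : ℂ) / (m + 1 + 1 + 1 : ℕ)) • spinProj (m + 1 + 1) (m + 1) := by
  have hT := torusInvariant_coupled (torusInvariant_ketBra (m + 1) 0)
  have h1 : scoreOperator nu (covariantDensity (m + 1) (ketBra (m + 1) 0)) =
      ((m + 1 + 1 : ℕ) : ℂ) • matrixIntegral nu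
        (orbit (coupled (m + 1)) (ketBra 1 0 ⊗ₖ ketBra (m + 1) 0)) := by
    ext a b
    rw [Matrix.smul_apply, smul_eq_mul]
    simp only [scoreOperator, matrixIntegral, Matrix.of_apply]
    rw [← integral_const_mul]
    refine integral_congr_ae (ae_of_all _ fun θ => ?_)
    simp only [coupled, orbit_tensor, covariantDensity, Matrix.kronecker_smul, Matrix.smul_apply,
      smul_eq_mul]
  have h2 : (spinProj (m + 1 + 1) (m + 1) * (ketBra 1 0 ⊗ₖ ketBra (m + 1) 0)).trace = 1 := by
    have := congrArg (fun A => (A * (ketBra 1 0 ⊗ₖ ketBra (m + 1) 0)).trace)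
      (spinProj_add_spinProj m)
    simpa [Matrix.add_mul, spinProj_minus_mul_highest, Matrix.trace_kronecker, trace_ketBra]
      using this
  rw [h1, matrixIntegral_orbit hT, twirl_coupled, h2, spinProj_minus_mul_highest,
    Matrix.trace_zero, zero_div, zero_smul, add_zero, smul_smul, mul_one_div]

/-- The score operator is a multiple of P_{j+½}, which commutes with the group, so conjugation by
the representative of θ drops out of the trace. -/
theorem averageGain_optimal (θ : Theta) :
    averageGain p hp (optimalPOVM (m + 1)) θ =
      (((m + 1 : ℕ) : ℝ) + 1) / (((m + 1 : ℕ) : ℝ) + 2) *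
        couplingWeight (m + 1 + 1) (m + 1) (diagState p) := by
  have hcomm : (coupled (m + 1)).toFun (rep θ) * spinProj (m + 1 + 1) (m + 1) =
      spinProj (m + 1 + 1) (m + 1) * (coupled (m + 1)).toFun (rep θ) := by
    rw [spinProj_plus]
    exact (((cgPlus_intertwines (m + 1)).mul (cgPlus_intertwines (m + 1)).conjTranspose) _).symm
  have htr : (orbit (coupled (m + 1)) (ketBra 1 0 ⊗ₖ diagState p) θ *
      spinProj (m + 1 + 1) (m + 1)).trace =
      (spinProj (m + 1 + 1) (m + 1) * (ketBra 1 0 ⊗ₖ diagState p)).trace := by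
    rw [orbit, Matrix.trace_mul_comm, ← Matrix.mul_assoc, ← Matrix.mul_assoc, ← hcomm,
      Matrix.trace_mul_comm, ← Matrix.mul_assoc, ← Matrix.mul_assoc,
      UnitaryRep.inv_mul_self, Matrix.one_mul]
  rw [optimalPOVM, averageGain_eq hp (isDensity_covariantPOVM (torusInvariant_ketBra (m + 1) 0)
    (ketBra_posSemidef (m + 1) 0) (trace_ketBra (m + 1) 0)), scoreOperator_optimal,
    Matrix.mul_smul, Matrix.trace_smul, htr, smul_eq_mul]
  have h : (((m + 1 + 1 : ℕ) : ℂ) / (m + 1 + 1 + 1 : ℕ)) =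
      (((((m + 1 : ℕ) : ℝ) + 1) / (((m + 1 : ℕ) : ℝ) + 2) : ℝ) : ℂ) := by
    push_cast
    congr 1
    ring
  rw [h, Complex.re_ofReal_mul]
  rfl

theorem worstGain_optimal : worstGain p hp (optimalPOVM (m + 1)) =
    (((m + 1 : ℕ) : ℝ) + 1) / (((m + 1 : ℕ) : ℝ) + 2) *
      couplingWeight (m + 1 + 1) (m + 1) (diagState p) := by
  simp only [worstGain, averageGain_optimal hp, ciInf_const]

theorem bayesGain_optimal : bayesGain p hp (optimalPOVM (m + 1)) =
    (((m + 1 : ℕ) : ℝ) + 1) / (((m + 1 : ℕ) : ℝ) + 2) *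
      couplingWeight (m + 1 + 1) (m + 1) (diagState p) := by
  simp [bayesGain, averageGain_optimal hp]

end Optimal

end SpinEstimation

end

open SpinEstimation in
theorem theorem1 (n : ℕ) (hn : 1 ≤ n) (p : Fin (n + 1) → ℝ) (hp : ∀ i, 0 ≤ p i)
    (hsum : ∑ i, p i = 1)
    (hcond : 1 / ((n : ℝ) + 2) * couplingWeight (n + 1) n (diagState p) ≥
      1 / (n : ℝ) * couplingWeight (n - 1) n (diagState p)) :
    IsGreatest (Set.range (worstGain p hp))
        (((n : ℝ) + 1) / ((n : ℝ) + 2) * couplingWeight (n + 1) n (diagState p)) ∧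
      IsGreatest (Set.range (bayesGain p hp))
        (((n : ℝ) + 1) / ((n : ℝ) + 2) * couplingWeight (n + 1) n (diagState p)) ∧
      ∃ M : POVM Theta (Fin (n + 1)),
        IsGeneratedBy M (ketBra n 0) ∧ IsCovariant M ∧
        worstGain p hp M =
          ((n : ℝ) + 1) / ((n : ℝ) + 2) * couplingWeight (n + 1) n (diagState p) ∧
        bayesGain p hp M =
          ((n : ℝ) + 1) / ((n : ℝ) + 2) * couplingWeight (n + 1) n (diagState p) := by
  -- With n = m + 1 the truncated subtraction `n - 1` reduces to `m`, the spin label of H_{j-½}.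
  obtain ⟨m, rfl⟩ : ∃ m, n = m + 1 := ⟨n - 1, by omega⟩
  have hle := bayesGain_le hp hcond
  refine ⟨⟨⟨_, worstGain_optimal hp⟩, ?_⟩, ⟨⟨_, bayesGain_optimal hp⟩, ?_⟩,
    optimalPOVM (m + 1), isGeneratedBy_covariantPOVM _ _ _, isCovariant_covariantPOVM _ _ _,
    worstGain_optimal hp, bayesGain_optimal hp⟩
  · rintro _ ⟨M, rfl⟩
    exact (worstGain_le_bayesGain hp M).trans (hle M)
  · rintro _ ⟨M, rfl⟩
    exact hle M
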